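/- Let $k$ be a field. Let $\mathcal C$ be the set of finite-type $\mathbb Z$-subalgebras of $k$, ordered by inclusion. A *realization* of a finite-type $k$-scheme $X$ is a family $(X_A)$ of finitely presented $A$-schemes, indexed by all $A\in\mathcal C$ containing some fixed element of $\mathcal C$, together with isomorphisms $X_A\times_A k\simeq X$ of $k$-schemes and, for $A\subset B$, $X_A\times_A B\simeq X_B$ of $B$-schemes. A realization of a morphism $f:X\to Y$ of finite-type $k$-schemes consists of realizations $(X_A)$, $(Y_A)$ of $X$, $Y$ with the same index set and $A$-morphisms $f_A:X_A\to Y_A$ such that these isomorphisms identify $f_A\times_A k$ with $f$ and $f_A\times_A B$ with $f_B$ for $A\subset B$. An $A$-scheme $Z$ has *integral geometric fibers* if $Z\times_A K$ is integral for every field $K$ and every ring homomorphism $A\to K$ (it is equivalent to let $K$ run over algebraic closures of the residue fields of $\mathrm{Spec}\,A$). Write $\mathrm{Im}$ for the scheme-theoretic image. **Theorem.** Let $f:X\to Y$ be a morphism of finite-type $k$-schemes with $Y$ proper over $k$, and let $(f_A:X_A\to Y_A)_A$ be a realization of $f$. Assume that $X_A$ has integral geometric fibers for some $A$ in the index set.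 Then $X$ is integral, and there is an $A_1$ in the index set such that: (i) The family $(\mathrm{Im}\,f_A)_{A\supset A_1}$ realizes $\mathrm{Im}\,f$; more precisely, it carries a realization of $\mathrm{Im}\,f$ for which the closed immersions $\mathrm{Im}\,f_A\hookrightarrow Y_A$ realize $\mathrm{Im}\,f\hookrightarrow Y$. If the isomorphisms given for $(Y_A)_{A\supset A_1}$ are coherent (satisfy the evident cocycle conditions), so are those for $(\mathrm{Im}\,f_A)_{A\supset A_1}$. (ii) For every $A\in\mathcal C$ containing $A_1$: (a) $X_A$ is integral and flat over $A$; (b) $\mathrm{Im}\,f_A$ is integral, has integral geometric fibers, and is flat, proper and of finite presentation over $A$; (c) for every non-empty scheme $T$ and every morphism $T\to\mathrm{Spec}\,A$ such that $(\mathrm{Im}\,f_A)_T$ and $(X_A)_T$ are integral, there is an isomorphism $\mathrm{Im}\,((f_A)_T)\simeq(\mathrm{Im}\,f_A)_T$ over $(Y_A)_T$. In particular, for every $s\in\mathrm{Spec}\,A$, writing $\bar s$ for the spectrum of an algebraic closure of the residue field of $s$, there is an isomorphism $\mathrm{Im}\,((f_A)_{\bar s})\simeq(\mathrm{Im}\,f_A)_{\bar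 s}$ over $(Y_A)_{\bar s}$. -/

import Mathlib

open CategoryTheory CategoryTheory.Limits AlgebraicGeometry

universe u

namespace SchemeRealization

/-- The `ℤ`-subalgebras of finite type of the field `k`, ordered by inclusion. -/
abbrev FGSub (k : Type u) [Field k] : Type u := {A : Subalgebra ℤ k // A.FG}

section

variable {k : Type u} [Field k]

/-- `Spec k`. -/
noncomputable abbrev specField (k : Type u) [Field k] : Scheme.{u} := Spec (CommRingCat.of k)

/-- `Spec A`, for a subalgebra `A` of `k` of finite type over `ℤ`. -/
noncomputable abbrev specSub (A : FGSub k) : Scheme.{u} := Spec (CommRingCat.of A.1)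

/-- The morphism `Spec k ⟶ Spec A` given by the inclusion of `A` in `k`. -/
noncomputable def fromField (A : FGSub k) : specField k ⟶ specSub A :=
  Spec.map (CommRingCat.ofHom A.1.val.toRingHom)

/-- The morphism `Spec B ⟶ Spec A` given by an inclusion of `A` in `B`. -/
noncomputable def fromSub {A B : FGSub k} (h : A ≤ B) : specSub B ⟶ specSub A :=
  Spec.map (CommRingCat.ofHom
    (Subalgebra.inclusion (show A.1 ≤ B.1 from h)).toRingHom)

/-- A realization of the `k`-scheme `X`: a family of finitely presented schemes `F A` over `A`,
one for each `A` containing `A₀`, together with isomorphisms `F A ×_A k ≃ X` and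
`F A ×_A B ≃ F B` for `A ⊆ B`. These isomorphisms are recorded by their first projections,
which exhibit `X` and `F B` as fibre products. -/
structure Realization {A₀ : FGSub k} (X : Over (specField k))
    (F : ∀ A : FGSub k, A₀ ≤ A → Over (specSub A)) where
  locallyOfFinitePresentation : ∀ A hA, LocallyOfFinitePresentation (F A hA).hom
  quasiCompact : ∀ A hA, QuasiCompact (F A hA).hom
  quasiSeparated : ∀ A hA, QuasiSeparated (F A hA).hom
  toModel : ∀ A hA, X.left ⟶ (F A hA).left
  isPullback_toModel : ∀ A hA,
    IsPullback (toModel A hA) X.hom (F A hA).hom (fromField A)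
  trans : ∀ {A B : FGSub k} (hA : A₀ ≤ A) (hAB : A ≤ B),
    (F B (hA.trans hAB)).left ⟶ (F A hA).left
  isPullback_trans : ∀ {A B : FGSub k} (hA : A₀ ≤ A) (hAB : A ≤ B),
    IsPullback (trans hA hAB) (F B (hA.trans hAB)).hom (F A hA).hom (fromSub hAB)

/-- The isomorphisms of a realization are coherent: they satisfy the cocycle conditions of a
projective system with a compatible cone. -/
structure Realization.IsCoherent {A₀ : FGSub k} {X : Over (specField k)}
    {F : ∀ A : FGSub k, A₀ ≤ A → Over (specSub A)} (R : Realization X F) : Prop where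
  trans_refl : ∀ {A : FGSub k} (hA : A₀ ≤ A), R.trans hA (le_refl A) = 𝟙 _
  trans_trans : ∀ {A B C : FGSub k} (hA : A₀ ≤ A) (hAB : A ≤ B) (hBC : B ≤ C),
    R.trans (hA.trans hAB) hBC ≫ R.trans hA hAB = R.trans hA (hAB.trans hBC)
  toModel_trans : ∀ {A B : FGSub k} (hA : A₀ ≤ A) (hAB : A ≤ B),
    R.toModel B (hA.trans hAB) ≫ R.trans hA hAB = R.toModel A hA

/-- The restriction of a realization to the `A` containing a larger `A₁`. -/
def Realization.restrict {A₀ A₁ : FGSub k} {X : Over (specField k)}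
    {F : ∀ A : FGSub k, A₀ ≤ A → Over (specSub A)} (R : Realization X F) (h : A₀ ≤ A₁) :
    Realization (A₀ := A₁) X (fun A hA => F A (h.trans hA)) where
  locallyOfFinitePresentation A hA := R.locallyOfFinitePresentation A (h.trans hA)
  quasiCompact A hA := R.quasiCompact A (h.trans hA)
  quasiSeparated A hA := R.quasiSeparated A (h.trans hA)
  toModel A hA := R.toModel A (h.trans hA)
  isPullback_toModel A hA := R.isPullback_toModel A (h.trans hA)
  trans hA hAB := R.trans (h.trans hA) hAB
  isPullback_trans hA hAB := R.isPullback_trans (h.trans hA) hAB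

/-- The family of morphisms `fA A : F A ⟶ G A` realizes the `k`-morphism `f : X ⟶ Y`, with respect
to realizations `R` of `X` and `Q` of `Y`: the isomorphisms of `R` and `Q` identify
`(fA A) ×_A k` with `f`, and `(fA A) ×_A B` with `fA B`. -/
structure RealizesHom {A₀ : FGSub k} {X Y : Over (specField k)}
    {F G : ∀ A : FGSub k, A₀ ≤ A → Over (specSub A)} (R : Realization X F) (Q : Realization Y G)
    (f : X ⟶ Y) (fA : ∀ A hA, F A hA ⟶ G A hA) : Prop where
  toModel_comm : ∀ A hA, R.toModel A hA ≫ (fA A hA).left = f.left ≫ Q.toModel A hA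
  trans_comm : ∀ {A B : FGSub k} (hA : A₀ ≤ A) (hAB : A ≤ B),
    R.trans hA hAB ≫ (fA A hA).left = (fA B (hA.trans hAB)).left ≫ Q.trans hA hAB

end

section

variable {S : Scheme.{u}} {X Y : Over S}

/-- The scheme-theoretic image of an `S`-morphism, as an `S`-scheme. -/
noncomputable def im (f : X ⟶ Y) : Over S := Over.mk (f.left.imageι ≫ Y.hom)

/-- The closed immersion of the scheme-theoretic image in the target. -/
noncomputable def imι (f : X ⟶ Y) : im f ⟶ Y := Over.homMk f.left.imageι rfl

/-- The construction of the scheme-theoretic image of the `S`-morphism `f : X ⟶ Y` commutes with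
the base change `t : T ⟶ S`: there is an isomorphism `Im (f_T) ≃ (Im f)_T` over `Y_T`. -/
def ImCommutesWith (f : X ⟶ Y) {T : Scheme.{u}} (t : T ⟶ S) : Prop :=
  ∃ e : im ((Over.pullback t).map f) ≅ (Over.pullback t).obj (im f),
    e.hom ≫ (Over.pullback t).map (imι f) = imι ((Over.pullback t).map f)

/-- The geometric point of `S` over `s` given by an algebraic closure of the residue field. -/
noncomputable def geometricPoint (s : S) :
    Spec (CommRingCat.of (AlgebraicClosure (S.residueField s))) ⟶ S :=
  Spec.map (CommRingCat.ofHom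
    (algebraMap (S.residueField s) (AlgebraicClosure (S.residueField s)))) ≫
      S.fromSpecResidueField s

end

end SchemeRealization

/-! Enlarging `A` inside `k` inverts any given non-zero element of `A`, so a property that holds
over a non-empty open subset of Spec A, and is stable under base change, holds for all large `A`.
The main point is that, for large `A`, the morphism from X_A to Im f_A stays scheme-theoretically
dominant after every base change (`ImageUniversal`). A base change of Im f_A is then a closed
subscheme of the base change of Y_A that is dominated by the base change of X_A, so it is the image
of the base-changed morphism. This gives the realization and the commutation with base change. It
also gives integral geometric fibers, since a scheme dominated by an integral one is integral.

Affine-locally the claim concerns an injection R → S of algebras of finite type over a Noetherian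
domain A, with R a domain (`GenericFlatness.exists_rTensor_injective`). Some R_r → S_r is faithfully
flat, hence universally injective, but r lies in R and only elements of A may be inverted. The gap
is the injectivity of R ⊗ B → R_r ⊗ B over A, that is, of multiplication by r on R ⊗ B. Generic
flatness of R/rR over A provides it as soon as a suitable s in A is invertible in B.

For properness, Im f is closed in Y, hence proper over k, and this must spread out to a finite level
(`SchemeRealization.exists_isProper`). If a valuative criterion failed over every B containing A,
the ultraproduct of the counterexamples would be a valuative square over k, because k maps to the
ultraproduct. Its solution descends to almost all factors by finite presentation, a contradiction.
-/

open scoped TensorProduct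

/-! ### Generic flatness and generic universal injectivity for algebras -/

namespace GenericFlatness

/-- An extension of flat modules is flat. -/
lemma flat_of_exact {R M N P : Type*} [CommRing R] [AddCommGroup M] [AddCommGroup N]
    [AddCommGroup P] [Module R M] [Module R N] [Module R P] {f : M →ₗ[R] N} {g : N →ₗ[R] P}
    (hf : Function.Injective f) (hg : Function.Surjective g) (h : Function.Exact f g)
    [Module.Flat R M] [Module.Flat R P] : Module.Flat R N := by
  rw [Module.Flat.iff_lTensor_injectiveₛ]
  intro Q _ _ I
  rw [injective_iff_map_eq_zero]
  let : AddCommGroup Q := Module.addCommMonoidToAddCommGroup R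
  intro x hx
  have h1 : g.rTensor I x = 0 := by
    apply Module.Flat.lTensor_preserves_injective_linearMap (M := P) I.subtype
      I.injective_subtype
    rw [map_zero, ← LinearMap.comp_apply, LinearMap.lTensor_comp_rTensor,
      ← LinearMap.rTensor_comp_lTensor, LinearMap.comp_apply, hx, map_zero]
  obtain ⟨y, rfl⟩ := (rTensor_exact I h hg x).mp h1
  have h2 : I.subtype.lTensor M y = 0 := by
    -- Flatness of the quotient `P` keeps `f` injective after tensoring with any module.
    have : Function.Injective (f.rTensor Q) := by
      rw [← LinearMap.lTensor_inj_iff_rTensor_inj]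
      exact LinearMap.lTensor_injective_of_exact_of_flat g hg f hf h Q
    apply this
    rw [map_zero, ← LinearMap.comp_apply, LinearMap.rTensor_comp_lTensor,
      ← LinearMap.lTensor_comp_rTensor, LinearMap.comp_apply, hx]
  rw [Module.Flat.lTensor_preserves_injective_linearMap (M := M) I.subtype
    I.injective_subtype (h2.trans (map_zero _).symm), map_zero]

/-- The union of an increasing sequence of flat submodules is flat. -/
lemma flat_of_iSup_eq_top {R M : Type*} [CommRing R] [AddCommGroup M] [Module R M]
    (N : ℕ → Submodule R M) (hN : Monotone N) (htop : ⨆ i, N i = ⊤)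
    (h : ∀ i, Module.Flat R (N i)) : Module.Flat R M := by
  rw [Module.Flat.iff_forall_isTrivialRelation]
  intro l f x hx
  have hmem (y : M) : ∃ i, y ∈ N i := by
    rw [← Submodule.mem_iSup_of_directed _ hN.directed_le, htop]; trivial
  choose j hj using fun i => hmem (x i)
  let n := Finset.univ.sup j
  let x' : Fin l → N n := fun i => ⟨x i, hN (Finset.le_sup (Finset.mem_univ i)) (hj i)⟩
  have hx' : ∑ i, f i • x' i = 0 := by
    apply Subtype.ext
    simpa [x'] using hx
  obtain ⟨k, a, y, h1, h2⟩ := Module.Flat.isTrivialRelation_of_sum_smul_eq_zero hx'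
  refine ⟨k, a, fun j => y j, fun i => ?_, h2⟩
  have := congrArg Subtype.val (h1 i)
  simpa [x'] using this

/-- The module `M` over the domain `A` becomes flat after inverting a non-zero element of `A`,
tested on flat algebras. -/
def GenericallyFlat (A M : Type u) [CommRing A] [AddCommGroup M] [Module A M] : Prop :=
  ∃ s : A, s ≠ 0 ∧ ∀ (B : Type u) [CommRing B] [Algebra A B] [Module.Flat A B],
    IsUnit (algebraMap A B s) → Module.Flat B (B ⊗[A] M)

/-- All finite modules over the `A`-algebra `R` are generically flat over `A`. -/
def GenericFlatnessHolds (A R : Type u) [CommRing A] [CommRing R] [Algebra A R] : Prop :=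
  ∀ (M : Type u) [AddCommGroup M] [Module A M] [Module R M] [IsScalarTower A R M]
    [Module.Finite R M], GenericallyFlat A M

lemma genericFlatnessHolds_self (A : Type u) [CommRing A] [IsDomain A] [IsNoetherianRing A] :
    GenericFlatnessHolds A A := by
  intro M _ m m' _ _
  -- With R = A the module carries two `A`-structures; the scalar tower forces them to agree.
  obtain rfl : m = m' := Module.ext' _ _ fun a x => by
    simpa using (@IsScalarTower.smul_assoc A A M _ m'.toSMul m.toSMul _ a (1 : A) x).symm
  have : Module.FinitePresentation A M := Module.finitePresentation_of_finite A M
  -- A finitely presented module that is free at the generic point is already free after inverting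
  -- one element.
  obtain ⟨r, hr, h, -⟩ := Module.FinitePresentation.exists_free_localizedModule_powers
    (nonZeroDivisors A) (LocalizedModule.mkLinearMap (nonZeroDivisors A) M) (FractionRing A)
  refine ⟨r, nonZeroDivisors.ne_zero hr, fun B _ _ _ hB => ?_⟩
  let φ : Localization.Away r →+* B := IsLocalization.Away.lift r hB
  let := φ.toAlgebra
  have : IsScalarTower A (Localization.Away r) B := .of_algebraMap_eq fun x =>
    (IsLocalization.Away.lift_eq r hB x).symm
  have : Module.Flat (Localization.Away r) (Localization.Away r ⊗[A] M) :=
    Module.Flat.of_linearEquiv (M := LocalizedModule.Away r M)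
      ((isLocalizedModule_iff_isBaseChange (.powers r) (Localization.Away r)
        (LocalizedModule.mkLinearMap (.powers r) M)).mp inferInstance).equiv
  exact Module.Flat.of_linearEquiv
    (TensorProduct.AlgebraTensorModule.cancelBaseChange A (Localization.Away r) B B M).symm

/-- A flat base change of a filtered module is flat if that of each graded piece is. -/
lemma flat_baseChange_of_filtration {A M B : Type*} [CommRing A] [AddCommGroup M] [Module A M]
    [CommRing B] [Algebra A B] [Module.Flat A B] (L : ℕ → Submodule A M) (hL : Monotone L)
    (h0 : L 0 = ⊥) (htop : ⨆ i, L i = ⊤)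
    (h : ∀ i, Module.Flat B (B ⊗[A] (L (i + 1) ⧸ (L i).submoduleOf (L (i + 1))))) :
    Module.Flat B (B ⊗[A] M) := by
  have key (i : ℕ) : Module.Flat B (B ⊗[A] L i) := by
    induction i with
    | zero =>
      have : Subsingleton (L 0) := by rw [h0]; infer_instance
      infer_instance
    | succ i ih =>
      have := h i
      have hex : Function.Exact (Submodule.inclusion (hL i.le_succ))
          ((L i).submoduleOf (L (i + 1))).mkQ := by
        rw [LinearMap.exact_iff, Submodule.ker_mkQ, Submodule.range_inclusion]
        rfl
      refine flat_of_exact (f := (Submodule.inclusion (hL i.le_succ)).baseChange B)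
        (g := ((L i).submoduleOf (L (i + 1))).mkQ.baseChange B) ?_ ?_ ?_
      · exact Module.Flat.lTensor_preserves_injective_linearMap (M := B) _
          (Submodule.inclusion_injective _)
      · exact LinearMap.lTensor_surjective B (Submodule.mkQ_surjective _)
      · exact lTensor_exact B hex (Submodule.mkQ_surjective _)
  let T (i : ℕ) : Submodule B (B ⊗[A] M) := ((L i).subtype.baseChange B).range
  refine flat_of_iSup_eq_top T ?_ ?_ fun i => ?_
  · intro i j hij
    rintro _ ⟨y, rfl⟩
    refine ⟨(Submodule.inclusion (hL hij)).baseChange B y, ?_⟩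
    rw [← LinearMap.comp_apply, ← LinearMap.baseChange_comp]
    rfl
  · rw [eq_top_iff]
    intro y _
    induction y with
    | zero => exact zero_mem _
    | add y z hy hz => exact add_mem (hy trivial) (hz trivial)
    | tmul b m =>
      have hm : m ∈ ⨆ i, L i := htop ▸ trivial
      rw [Submodule.mem_iSup_of_directed _ hL.directed_le] at hm
      obtain ⟨i, hi⟩ := hm
      exact Submodule.mem_iSup_of_mem i ⟨b ⊗ₜ ⟨m, hi⟩, rfl⟩
  · have := key i
    exact Module.Flat.of_linearEquiv (LinearEquiv.ofInjective ((L i).subtype.baseChange B)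
      (Module.Flat.lTensor_preserves_injective_linearMap (M := B) _
        (L i).injective_subtype)).symm

/-- Filter M by the R-submodules N + XN + ... + X^(i-1)N, where N is the R-span of finitely many
generators. The graded pieces are quotients N/K_i with K_i increasing in a Noetherian module, so
only finitely many different ones occur, and a product of finitely many elements of A makes all of
them flat. -/
lemma GenericFlatnessHolds.polynomial {A R : Type u} [CommRing A] [IsDomain A] [CommRing R]
    [Algebra A R] [IsNoetherianRing R] (hR : GenericFlatnessHolds A R) :
    GenericFlatnessHolds A (Polynomial R) := by
  intro M _ _ _ _ _
  let _ : Module R M := Module.compHom M (Polynomial.C (R := R))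
  have : IsScalarTower R (Polynomial R) M := .of_algebraMap_smul fun _ _ => rfl
  have : IsScalarTower A R M := ⟨fun a r m => by
    rw [← algebraMap_smul (Polynomial R) (a • r) m, Algebra.smul_def, map_mul, mul_smul,
      ← IsScalarTower.algebraMap_apply, algebraMap_smul, algebraMap_smul]⟩
  obtain ⟨S, hS⟩ := Module.Finite.fg_top (R := Polynomial R) (M := M)
  let N : Submodule R M := Submodule.span R S
  have : Module.Finite R N := Module.Finite.span_finset R S
  let x : Module.End R M := Algebra.lsmul R R M (Polynomial.X : Polynomial R)
  -- The exponents stop at i - 1, so `L 0` is zero, as the filtration lemma requires.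
  let L (i : ℕ) : Submodule R M := (Finset.range i).sup fun j => N.map (x ^ j)
  have hL : Monotone L := fun i j h => Finset.sup_mono (Finset.range_mono h)
  have hLs (i : ℕ) : L (i + 1) = L i ⊔ N.map (x ^ i) := by
    simp only [L, Finset.range_add_one, Finset.sup_insert, sup_comm]
  have hx (i : ℕ) : (L i).map x ≤ L (i + 1) := by
    simp only [L, Finset.sup_eq_iSup, Submodule.map_iSup]
    refine iSup₂_le fun j hj => ?_
    refine le_trans ?_ (le_iSup₂_of_le (j + 1) (by simpa using hj) le_rfl)
    rw [← Submodule.map_comp, pow_succ']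
    rfl
  have htop : ⨆ i, L i = ⊤ := by
    have hmem {m : M} : m ∈ ⨆ i, L i ↔ ∃ i, m ∈ L i :=
      Submodule.mem_iSup_of_directed _ hL.directed_le
    have hX (n : ℕ) (m : M) (hm : m ∈ ⨆ i, L i) :
        (Polynomial.X ^ n : Polynomial R) • m ∈ ⨆ i, L i := by
      induction n with
      | zero => simpa using hm
      | succ n ih =>
        obtain ⟨i, hi⟩ := hmem.mp ih
        rw [pow_succ', mul_smul]
        exact hmem.mpr ⟨i + 1, hx i ⟨_, hi, rfl⟩⟩
    let T : Submodule (Polynomial R) M :=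
      { (⨆ i, L i).toAddSubmonoid with
        smul_mem' := fun p m (hm : m ∈ ⨆ i, L i) => show p • m ∈ ⨆ i, L i by
          induction p using Polynomial.induction_on' with
          | add p q hp hq => rw [add_smul]; exact add_mem hp hq
          | monomial n a =>
            rw [← Polynomial.C_mul_X_pow_eq_monomial, mul_smul]
            exact Submodule.smul_mem (⨆ i, L i) a (hX n m hm) }
    have hT : T = ⊤ := by
      rw [eq_top_iff, ← hS, Submodule.span_le]
      intro m hm
      refine hmem.mpr ⟨1, ?_⟩
      simpa [L] using Submodule.subset_span hm
    rw [eq_top_iff]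
    intro m _
    exact show m ∈ T from hT ▸ trivial
  -- `K i` is the kernel of the surjection X^i from N to L_{i+1}/L_i; it grows with i because X maps
  -- L_i into L_{i+1}.
  let K : ℕ →o Submodule R N := ⟨fun i => (L i).comap ((x ^ i).comp N.subtype),
    monotone_nat_of_le_succ fun i n hn => by
      have := hx i ⟨_, hn, rfl⟩
      simpa [pow_succ'] using this⟩
  obtain ⟨n, hn⟩ := monotone_stabilizes_iff_noetherian.mpr (inferInstance : IsNoetherian R N) K
  choose s hs hs' using fun i => hR (N ⧸ K i)
  refine ⟨∏ i ∈ Finset.range (n + 1), s i, Finset.prod_ne_zero_iff.mpr fun i _ => hs i,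
    fun B _ _ _ hB => ?_⟩
  have hflat (i : ℕ) : Module.Flat B (B ⊗[A] (N ⧸ K i)) := by
    have (i : ℕ) (hi : i ≤ n) : Module.Flat B (B ⊗[A] (N ⧸ K i)) :=
      -- Since generic flatness is tested on every flat B in which the element is a unit, it passes
      -- to multiples of that element.
      hs' i B (isUnit_of_dvd_unit (map_dvd _ (Finset.dvd_prod_of_mem _ (by simp; lia))) hB)
    obtain hi | hi := le_total i n
    · exact this i hi
    · rw [← hn i hi]
      exact this n le_rfl
  refine flat_baseChange_of_filtration (fun i => (L i).restrictScalars A) (fun i j h => hL h)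
    (by simp [L]) (by simp [← Submodule.restrictScalars_iSup, htop]) fun i => ?_
  let φ : N →ₗ[R] L (i + 1) := ((x ^ i).comp N.subtype).codRestrict _ fun m =>
    (hLs i ▸ le_sup_right : N.map (x ^ i) ≤ L (i + 1)) ⟨m, m.2, rfl⟩
  let ψ : N →ₗ[R] L (i + 1) ⧸ (L i).submoduleOf (L (i + 1)) := (Submodule.mkQ _).comp φ
  have hψ : Function.Surjective ψ := by
    intro q
    obtain ⟨⟨m, hm⟩, rfl⟩ := Submodule.mkQ_surjective _ q
    rw [hLs, Submodule.mem_sup] at hm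
    obtain ⟨y, hy, _, ⟨z, hz, rfl⟩, rfl⟩ := hm
    refine ⟨⟨z, hz⟩, ?_⟩
    refine (Submodule.Quotient.eq _).mpr (show _ ∈ L i from ?_)
    simpa [φ] using hy
  have hker : K i = ψ.ker := by
    ext m
    simp only [ψ, LinearMap.ker_comp, Submodule.ker_mkQ]
    rfl
  have := hflat i
  let e : (N ⧸ K i) ≃ₗ[R] L (i + 1) ⧸ (L i).submoduleOf (L (i + 1)) :=
    (Submodule.quotEquivOfEq _ _ hker).trans (ψ.quotKerEquivOfSurjective hψ)
  let e' : (N ⧸ K i) ≃ₗ[A] ((L (i + 1)).restrictScalars A ⧸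
      ((L i).restrictScalars A).submoduleOf ((L (i + 1)).restrictScalars A)) :=
    e.restrictScalars A
  exact Module.Flat.of_linearEquiv (e'.baseChange A B _ _).symm

lemma GenericFlatnessHolds.of_surjective {A R R' : Type u} [CommRing A] [CommRing R] [CommRing R']
    [Algebra A R] [Algebra A R'] (hR : GenericFlatnessHolds A R) (f : R →ₐ[A] R')
    (hf : Function.Surjective f) : GenericFlatnessHolds A R' := by
  intro M _ _ _ _ _
  let _ : Module R M := Module.compHom M f.toRingHom
  let _ : Algebra R R' := f.toAlgebra
  have : IsScalarTower R R' M := .of_algebraMap_smul fun _ _ => rfl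
  have : IsScalarTower A R M := ⟨fun a r m => by
    change f (a • r) • m = a • f r • m
    rw [map_smul, smul_assoc]⟩
  have : Module.Finite R R' := .of_surjective (Algebra.linearMap R R') hf
  have : Module.Finite R M := .trans R' M
  exact hR M

/-- Generic flatness over a Noetherian domain. -/
lemma genericFlatnessHolds_of_finiteType (A R : Type u) [CommRing A] [IsDomain A]
    [IsNoetherianRing A] [CommRing R] [Algebra A R] [Algebra.FiniteType A R] :
    GenericFlatnessHolds A R := by
  obtain ⟨n, f, hf⟩ := Algebra.FiniteType.iff_quotient_mvPolynomial''.mp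
    (inferInstance : Algebra.FiniteType A R)
  refine .of_surjective ?_ f hf
  clear f hf
  induction n with
  | zero =>
    exact (genericFlatnessHolds_self A).of_surjective
      (MvPolynomial.isEmptyAlgEquiv A (Fin 0)).symm.toAlgHom
      (MvPolynomial.isEmptyAlgEquiv A (Fin 0)).symm.surjective
  | succ n ih =>
    exact ih.polynomial.of_surjective (MvPolynomial.finSuccEquiv A n).symm.toAlgHom
      (MvPolynomial.finSuccEquiv A n).symm.surjective

lemma GenericallyFlat.exists_flat_away {A M : Type u} [CommRing A] [AddCommGroup M] [Module A M]
    (h : GenericallyFlat A M) : ∃ s : A, s ≠ 0 ∧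
      Module.Flat (Localization.Away s) (Localization.Away s ⊗[A] M) := by
  obtain ⟨s, hs, h⟩ := h
  exact ⟨s, hs, h _ (IsLocalization.Away.algebraMap_isUnit s)⟩

lemma flat_baseChange_of_flat_away {A M : Type*} [CommRing A] [AddCommGroup M] [Module A M] {s : A}
    [Module.Flat (Localization.Away s) (Localization.Away s ⊗[A] M)] (B : Type*) [CommRing B]
    [Algebra A B] (hB : IsUnit (algebraMap A B s)) : Module.Flat B (B ⊗[A] M) := by
  let φ : Localization.Away s →+* B := IsLocalization.Away.lift s hB
  let _ := φ.toAlgebra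
  have : IsScalarTower A (Localization.Away s) B := .of_algebraMap_eq fun x =>
    (IsLocalization.Away.lift_eq s hB x).symm
  exact Module.Flat.of_linearEquiv
    (TensorProduct.AlgebraTensorModule.cancelBaseChange A (Localization.Away s) B B M).symm

/-- An exact sequence whose last term becomes flat after inverting `s` remains exact
after a base change in which `s` becomes invertible. -/
lemma lTensor_injective_of_flat_away {A M N P : Type*} [CommRing A] [AddCommGroup M]
    [AddCommGroup N] [AddCommGroup P] [Module A M] [Module A N] [Module A P] {f : M →ₗ[A] N}
    {g : N →ₗ[A] P} (hf : Function.Injective f) (hg : Function.Surjective g)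
    (h : Function.Exact f g) {s : A}
    [Module.Flat (Localization.Away s) (Localization.Away s ⊗[A] P)] (B : Type*) [CommRing B]
    [Algebra A B] (hB : IsUnit (algebraMap A B s)) : Function.Injective (f.lTensor B) := by
  let φ : Localization.Away s →+* B := IsLocalization.Away.lift s hB
  let _ := φ.toAlgebra
  have : IsScalarTower A (Localization.Away s) B := .of_algebraMap_eq fun x =>
    (IsLocalization.Away.lift_eq s hB x).symm
  have h1 := LinearMap.lTensor_injective_of_exact_of_flat
    (g.baseChange (Localization.Away s)) (LinearMap.lTensor_surjective _ hg)
    (f.baseChange (Localization.Away s))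
    (Module.Flat.lTensor_preserves_injective_linearMap (M := Localization.Away s) f hf)
    (lTensor_exact (Localization.Away s) h hg) B
  let eM := TensorProduct.AlgebraTensorModule.cancelBaseChange A (Localization.Away s) B B M
  let eN := TensorProduct.AlgebraTensorModule.cancelBaseChange A (Localization.Away s) B B N
  have h2 : (f.baseChange B).comp eM.toLinearMap =
      eN.toLinearMap.comp
        (TensorProduct.AlgebraTensorModule.lTensor B B (f.baseChange (Localization.Away s))) := by
    ext
    simp [eM, eN]
  have h3 : Function.Injective ((f.baseChange B).comp eM.toLinearMap) := by
    rw [h2]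
    exact eN.injective.comp h1
  intro x y hxy
  obtain ⟨x, rfl⟩ := eM.surjective x
  obtain ⟨y, rfl⟩ := eM.surjective y
  exact congrArg _ (h3 hxy)

/-- Over R_r the algebra is flat of finite presentation, so its spectrum has open image. The image
is non-empty since S_r is non-zero, and Spec R_r is open in Spec R. -/
lemma exists_basicOpen_subset_range_comap {R S : Type u} [CommRing R] [IsDomain R]
    [IsNoetherianRing R] [CommRing S] [Algebra R S] [Algebra.FiniteType R S] (r : R)
    (hr : r ≠ 0) (hRS : Function.Injective (algebraMap R S))
    [Module.Flat (Localization.Away r) (Localization.Away r ⊗[R] S)] :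
    ∃ a : R, a ≠ 0 ∧ (PrimeSpectrum.basicOpen a : Set (PrimeSpectrum R)) ⊆
      Set.range (PrimeSpectrum.comap (algebraMap R S)) := by
  have hM : Submonoid.powers r ≤ nonZeroDivisors R := powers_le_nonZeroDivisors_of_noZeroDivisors hr
  have : IsDomain (Localization.Away r) := IsLocalization.isDomain_localization hM
  have : IsNoetherianRing (Localization.Away r) :=
    IsLocalization.isNoetherianRing (.powers r) _ inferInstance
  have : Algebra.FinitePresentation (Localization.Away r) (Localization.Away r ⊗[R] S) :=
    Algebra.FinitePresentation.of_finiteType.mp inferInstance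
  have : Nontrivial (Localization.Away r ⊗[R] S) := by
    have : Function.Injective (algebraMap (Localization.Away r) (Localization.Away r ⊗[R] S)) :=
      Algebra.TensorProduct.includeLeft_injective (S := R) hRS
    exact this.nontrivial
  have hopen := (PrimeSpectrum.isOpenMap_comap_of_hasGoingDown_of_finitePresentation
    (R := Localization.Away r) (S := Localization.Away r ⊗[R] S)).isOpen_range
  have hopen' := (PrimeSpectrum.localization_away_isOpenEmbedding
    (Localization.Away r) r).isOpenMap _ hopen
  obtain ⟨q⟩ : Nonempty (PrimeSpectrum (Localization.Away r ⊗[R] S)) := inferInstance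
  obtain ⟨_, ⟨a, rfl⟩, ha, hs⟩ := PrimeSpectrum.isTopologicalBasis_basic_opens.exists_subset_of_mem_open
    (Set.mem_image_of_mem _ (Set.mem_range_self q)) hopen'
  refine ⟨a, ?_, hs.trans ?_⟩
  · rintro rfl
    simp at ha
  · rintro _ ⟨_, ⟨q, rfl⟩, rfl⟩
    let _ : Algebra S (Localization.Away r ⊗[R] S) := Algebra.TensorProduct.rightAlgebra
    refine ⟨PrimeSpectrum.comap (algebraMap S _) q, ?_⟩
    rw [← PrimeSpectrum.comap_comp_apply, ← PrimeSpectrum.comap_comp_apply,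
      ← IsScalarTower.algebraMap_eq, ← IsScalarTower.algebraMap_eq]

/-- Over a Noetherian domain, an injective algebra of finite type
becomes faithfully flat after inverting an element. -/
lemma exists_faithfullyFlat_away {R S : Type u} [CommRing R] [IsDomain R]
    [IsNoetherianRing R] [CommRing S] [Algebra R S] [Algebra.FiniteType R S]
    (hRS : Function.Injective (algebraMap R S)) : ∃ r : R, r ≠ 0 ∧
      Module.FaithfullyFlat (Localization.Away r) (Localization.Away r ⊗[R] S) := by
  obtain ⟨r, hr, h⟩ := (genericFlatnessHolds_of_finiteType R S S).exists_flat_away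
  obtain ⟨a, ha, h'⟩ := exists_basicOpen_subset_range_comap r hr hRS
  -- Inverting r gives flatness; inverting a gives surjectivity on spectra.
  refine ⟨r * a, mul_ne_zero hr ha, ?_⟩
  have hu := IsLocalization.Away.algebraMap_isUnit (S := Localization.Away (r * a)) (r * a)
  have := flat_baseChange_of_flat_away (M := S) (s := r) (Localization.Away (r * a))
    (isUnit_of_dvd_unit (map_dvd _ (dvd_mul_right _ _)) hu)
  refine .of_comap_surjective fun p => ?_
  have hp : PrimeSpectrum.comap (algebraMap R _) p ∈ PrimeSpectrum.basicOpen (r * a) := by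
    rw [← SetLike.mem_coe, ← PrimeSpectrum.localization_away_comap_range
      (Localization.Away (r * a)) (r * a)]
    exact ⟨p, rfl⟩
  rw [PrimeSpectrum.basicOpen_mul] at hp
  obtain ⟨q, hq⟩ := h' hp.2
  let _ : Algebra S (Localization.Away (r * a) ⊗[R] S) := Algebra.TensorProduct.rightAlgebra
  -- A prime of S over a point of D(ra) contains no power of ra, so it comes from the localization.
  have hqr : q ∈ Set.range (PrimeSpectrum.comap
      (algebraMap S (Localization.Away (r * a) ⊗[R] S))) := by
    rw [PrimeSpectrum.localization_comap_range _
      (Algebra.algebraMapSubmonoid S (.powers (r * a)))]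
    rw [← PrimeSpectrum.basicOpen_mul] at hp
    refine Set.disjoint_left.mpr ?_
    rintro _ ⟨x, ⟨n, rfl⟩, rfl⟩ hx
    refine hp (hq ▸ show algebraMap R S (r * a) ∈ q.asIdeal from
      q.isPrime.mem_of_pow_mem n ?_)
    simpa using hx
  obtain ⟨q', rfl⟩ := hqr
  refine ⟨q', PrimeSpectrum.localization_comap_injective (Localization.Away (r * a))
    (.powers (r * a)) ?_⟩
  rw [← hq, ← PrimeSpectrum.comap_comp_apply, ← PrimeSpectrum.comap_comp_apply,
    ← IsScalarTower.algebraMap_eq, ← IsScalarTower.algebraMap_eq]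

/-- An injective homomorphism of finitely generated algebras over a Noetherian domain, whose source
is a domain, becomes universally injective after inverting an element. -/
theorem exists_rTensor_injective (A R S : Type u) [CommRing A] [IsDomain A] [IsNoetherianRing A]
    [CommRing R] [IsDomain R] [CommRing S] [Algebra A R] [Algebra A S] [Algebra R S]
    [IsScalarTower A R S] [Algebra.FiniteType A R] [Algebra.FiniteType A S]
    (hRS : Function.Injective (algebraMap R S)) : ∃ s : A, s ≠ 0 ∧
      ∀ (B : Type u) [CommRing B] [Algebra A B], IsUnit (algebraMap A B s) →
        Function.Injective ((IsScalarTower.toAlgHom A R S).toLinearMap.rTensor B) := by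
  have : IsNoetherianRing R := Algebra.FiniteType.isNoetherianRing A R
  have : Algebra.FiniteType R S := .of_restrictScalars_finiteType A R S
  obtain ⟨r, hr, hff⟩ := exists_faithfullyFlat_away hRS
  obtain ⟨s, hs, hfl⟩ := (genericFlatnessHolds_of_finiteType A R
    (R ⧸ Ideal.span {r})).exists_flat_away
  refine ⟨s, hs, fun B _ _ hB => ?_⟩
  let R' := Localization.Away r
  let T := R' ⊗[R] S
  -- Tensor 0 → R → R → R/rR → 0, the first map being multiplication by r, with B: the quotient is
  -- flat over A_s.
  have h1 : Function.Injective ((LinearMap.mulLeft A r).lTensor B) := by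
    refine lTensor_injective_of_flat_away (g := (Ideal.Quotient.mkₐ A (Ideal.span {r})).toLinearMap)
      (mul_right_injective₀ hr) Ideal.Quotient.mk_surjective (fun x => ?_) B hB
    change Ideal.Quotient.mk _ x = 0 ↔ ∃ y, r * y = x
    rw [Ideal.Quotient.eq_zero_iff_mem, Ideal.mem_span_singleton]
    exact exists_congr fun y => eq_comm
  rw [LinearMap.lTensor_inj_iff_rTensor_inj] at h1
  have h1' (x : R ⊗[A] B) : (LinearMap.mulLeft A r).rTensor B x = r • x := by
    induction x with
    | zero => simp
    | add x y hx hy => simp [hx, hy]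
    | tmul x b => simp [TensorProduct.smul_tmul']
  -- The kernel of localization at r is the r-power torsion, which vanishes by `h1`.
  have h2 : Function.Injective ((IsScalarTower.toAlgHom A R R').toLinearMap.rTensor B) := by
    rw [injective_iff_map_eq_zero]
    intro x hx
    obtain ⟨⟨_, n, rfl⟩, hn⟩ := IsLocalizedModule.exists_of_eq (S := Submonoid.powers r)
      (f := TensorProduct.AlgebraTensorModule.rTensor A B (Algebra.linearMap R R'))
      (x₁ := x) (x₂ := 0) (hx.trans (map_zero _).symm)
    simp only [smul_zero] at hn
    clear hx
    induction n with
    | zero => simpa using hn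
    | succ n ih =>
      refine ih (h1 ?_)
      rw [h1', map_zero]
      simpa [pow_succ', mul_smul, Submonoid.smul_def] using hn
  have h3 : Function.Injective ((IsScalarTower.toAlgHom A R' T).toLinearMap.rTensor B) := by
    let e := TensorProduct.AlgebraTensorModule.cancelBaseChange A R' R' T B
    have h : (IsScalarTower.toAlgHom A R' T).toLinearMap.rTensor B =
        (e.toLinearMap ∘ₗ TensorProduct.mk R' T (R' ⊗[A] B) 1).restrictScalars A := by
      ext x b
      simp [e, Algebra.algebraMap_eq_smul_one]
    rw [h]
    exact e.injective.comp
      (Module.FaithfullyFlat.tensorProduct_mk_injective (A := R') (B := T) (R' ⊗[A] B))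
  let ι : S →ₐ[A] T := (Algebra.TensorProduct.includeRight : S →ₐ[R] T).restrictScalars A
  have h4 : (ι.toLinearMap.rTensor B) ∘ₗ
      ((IsScalarTower.toAlgHom A R S).toLinearMap.rTensor B) =
      ((IsScalarTower.toAlgHom A R' T).toLinearMap.rTensor B) ∘ₗ
      ((IsScalarTower.toAlgHom A R R').toLinearMap.rTensor B) := by
    rw [← LinearMap.rTensor_comp, ← LinearMap.rTensor_comp]
    congr 1
    ext x
    exact congr(($(Algebra.TensorProduct.includeRight (R := R) (A := R') (B := S).comp_algebraMap) x)).trans (IsScalarTower.algebraMap_apply R R' T x)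
  -- Followed by S ⊗ B → T ⊗ B, the map in question becomes the composite through R' ⊗ B of two
  -- injections.
  refine Function.Injective.of_comp (f := ι.toLinearMap.rTensor B) ?_
  rw [← LinearMap.coe_comp, h4]
  exact h3.comp h2

end GenericFlatness

/-! ### Scheme-theoretic dominance, images and base change -/

namespace AlgebraicGeometry

/-- Restricting the source can only enlarge the kernel ideal. Hence over each chart any W mapping to
X will do; it need not be the whole preimage. -/
lemma IsSchemeTheoreticallyDominant.of_openCover {X Y : Scheme.{u}} (f : X ⟶ Y) (𝒱 : Y.OpenCover)
    (h : ∀ j, ∃ (W : Scheme.{u}) (w : W ⟶ X) (g : W ⟶ 𝒱.X j), g ≫ 𝒱.f j = w ≫ f ∧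
      IsSchemeTheoreticallyDominant g) : IsSchemeTheoreticallyDominant f := by
  constructor
  rw [← Scheme.isIso_subschemeι_iff_eq_bot]
  refine (IsZariskiLocalAtTarget.iff_of_openCover (P := MorphismProperty.isomorphisms Scheme)
    𝒱).mpr fun j => ?_
  obtain ⟨W, w, g, hw, hg⟩ := h j
  have h1 : f.ker.comap (𝒱.f j) = ⊥ := by
    rw [← le_bot_iff, ← Scheme.IdealSheafData.le_map_iff_comap_le, ← g.ker_eq_bot,
      ← Scheme.Hom.ker_comp, hw]
    exact Scheme.Hom.le_ker_comp _ _
  have h2 : (pullback.fst (𝒱.f j) f.ker.subschemeι).ker = ⊥ := by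
    rw [Scheme.IdealSheafData.ker_fst_of_isClosedImmersion, Scheme.IdealSheafData.ker_subschemeι,
      h1]
  have h3 : IsIso (pullback.fst (𝒱.f j) f.ker.subschemeι) :=
    IsClosedImmersion.isIso_iff_ker_eq_bot.mpr h2
  change IsIso (pullback.snd _ _)
  rw [← pullbackSymmetry_hom_comp_fst]
  infer_instance

/-- A closed subscheme of the image through which X factors is closed in Y and factors f, so it is
the whole image. -/
instance {X Y : Scheme.{u}} (f : X ⟶ Y) : IsSchemeTheoreticallyDominant f.toImage := by
  constructor
  rw [← Scheme.isIso_subschemeι_iff_eq_bot]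
  refine IsClosedImmersion.isIso_of_ker_eq (f.toImage.ker.subschemeι ≫ f.imageι) f.imageι _ rfl
    (le_antisymm ?_ (Scheme.Hom.le_ker_comp _ _))
  have : f.toImage.toImage ≫ f.toImage.ker.subschemeι ≫ f.imageι = f := by
    change f.toImage.toImage ≫ f.toImage.imageι ≫ f.imageι = f
    simp
  have h := Scheme.Hom.le_ker_comp f.toImage.toImage (f.toImage.ker.subschemeι ≫ f.imageι)
  rw [this] at h
  simpa [Scheme.Hom.imageι] using h

/-- If the source of a scheme-theoretically dominant quasi-compact morphism is integral,
so is its target. -/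
lemma IsSchemeTheoreticallyDominant.isIntegral {X Y : Scheme.{u}} (f : X ⟶ Y)
    [IsSchemeTheoreticallyDominant f] [QuasiCompact f] [IsIntegral X] : IsIntegral Y := by
  have : IsReduced Y := IsSchemeTheoreticallyDominant.isReduced f
  have : IrreducibleSpace Y := by
    have h : IsIrreducible (Set.univ : Set Y) := by
      have := (IrreducibleSpace.isIrreducible_univ X).image f f.continuous.continuousOn
      rw [Set.image_univ] at this
      simpa [f.denseRange.closure_range] using this.closure
    exact (irreducibleSpace_def _).mpr h
  exact isIntegral_of_irreducibleSpace_of_isReduced Y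

/-- Every base change of the `S`-morphism `h : X ⟶ Z` along `t : T ⟶ S` is
scheme-theoretically dominant. -/
def SchemeTheoreticallyDominantAfter {X Z S T : Scheme.{u}} (h : X ⟶ Z) (p : Z ⟶ S) (t : T ⟶ S) :
    Prop :=
  ∀ ⦃X' Z' : Scheme.{u}⦄ (x : X' ⟶ X) (z : Z' ⟶ Z) (h' : X' ⟶ Z') (p' : Z' ⟶ T),
    IsPullback x h' h z → IsPullback z p' p t → IsSchemeTheoreticallyDominant h'

lemma SchemeTheoreticallyDominantAfter.of_isPullback {X Z S T T' X' Z' : Scheme.{u}} {h : X ⟶ Z}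
    {p : Z ⟶ S} {t : T ⟶ S} {t' : T' ⟶ T}
    (H : SchemeTheoreticallyDominantAfter h p (t' ≫ t)) {x : X' ⟶ X} {h' : X' ⟶ Z'} {z : Z' ⟶ Z}
    {p' : Z' ⟶ T} (hx : IsPullback x h' h z) (hz : IsPullback z p' p t) :
    SchemeTheoreticallyDominantAfter h' p' t' := fun _ _ _ _ _ _ h₁ h₂ =>
  H _ _ _ _ (h₁.paste_horiz hx) (h₂.paste_horiz hz)

section

variable {X Y S T X' Y' : Scheme.{u}} {f : X ⟶ Y} {pY : Y ⟶ S} {t : T ⟶ S} {f' : X' ⟶ Y'}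
  {pY' : Y' ⟶ T} {x : X' ⟶ X} {y : Y' ⟶ Y}

/-- The left side is the ideal of the pulled-back image in Y'. By hypothesis X' dominates that
closed subscheme, so its ideal is the kernel of f'. -/
lemma SchemeTheoreticallyDominantAfter.comap_ker
    (H : SchemeTheoreticallyDominantAfter f.toImage (f.imageι ≫ pY) t)
    (hx : IsPullback x f' f y) (hy : IsPullback y pY' pY t) : f.ker.comap y = f'.ker := by
  have hP := IsPullback.of_hasPullback f.imageι y
  obtain ⟨h', h1, h2⟩ : ∃ h' : X' ⟶ pullback f.imageι y,
      h' ≫ pullback.fst f.imageι y = x ≫ f.toImage ∧ h' ≫ pullback.snd f.imageι y = f' :=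
    ⟨hP.lift (x ≫ f.toImage) f' (by simp [hx.w]), hP.lift_fst _ _ _, hP.lift_snd _ _ _⟩
  have hh' : IsPullback x h' f.toImage (pullback.fst f.imageι y) :=
    IsPullback.of_bot (by simpa [h2] using hx) h1.symm hP
  have := H x (pullback.fst f.imageι y) h' (pullback.snd f.imageι y ≫ pY') hh'
    (hP.paste_vert hy)
  rw [← h2, Scheme.Hom.ker_comp, h'.ker_eq_bot, Scheme.IdealSheafData.map_bot,
    ← pullbackSymmetry_hom_comp_fst, Scheme.Hom.ker_comp_of_isIso,
    Scheme.IdealSheafData.ker_fst_of_isClosedImmersion]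
  simp [Scheme.Hom.imageι]

/-- The formation of the scheme-theoretic image commutes with a base change that preserves the
scheme-theoretic dominance of the morphism to the image. -/
lemma SchemeTheoreticallyDominantAfter.exists_isPullback
    (H : SchemeTheoreticallyDominantAfter f.toImage (f.imageι ≫ pY) t)
    (hx : IsPullback x f' f y) (hy : IsPullback y pY' pY t) :
    ∃ m : f'.image ⟶ f.image, IsPullback m f'.imageι f.imageι y ∧
      IsPullback x f'.toImage f.toImage m := by
  have hk := H.comap_ker hx hy
  let m : f'.image ⟶ f.image := IsClosedImmersion.lift f.imageι (f'.imageι ≫ y) (by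
    simp only [Scheme.Hom.imageι, Scheme.IdealSheafData.ker_subschemeι, Scheme.Hom.ker_comp]
    rw [Scheme.IdealSheafData.le_map_iff_comap_le, hk])
  have hm : m ≫ f.imageι = f'.imageι ≫ y := IsClosedImmersion.lift_fac _ _ _
  have hmp : IsPullback m f'.imageι f.imageι y :=
    (isPullback_of_isClosedImmersion f'.imageι f.imageι m y hm.symm
      (by simpa [Scheme.Hom.imageι] using hk)).flip
  refine ⟨m, hmp, .of_bot (by simpa using hx) ?_ hmp⟩
  rw [← cancel_mono f.imageι]
  simp [hm, hx.w]

end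

lemma IsSchemeTheoreticallyDominant.specMap {R S : CommRingCat.{u}} (φ : R ⟶ S)
    (hφ : Function.Injective φ) : IsSchemeTheoreticallyDominant (Spec.map φ) := by
  constructor
  rw [Scheme.ker_of_isAffine]
  have : RingHom.ker (Spec.map φ).appTop.hom = ⊥ := by
    rw [← RingHom.injective_iff_ker_eq_bot]
    have h : Function.Injective ((Scheme.ΓSpecIso R).inv ≫ (Spec.map φ).appTop) := by
      rw [← Scheme.ΓSpecIso_inv_naturality]
      exact (Scheme.ΓSpecIso S).symm.commRingCatIsoToRingEquiv.injective.comp hφ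
    intro x y hxy
    obtain ⟨x, rfl⟩ := (Scheme.ΓSpecIso R).symm.commRingCatIsoToRingEquiv.surjective x
    obtain ⟨y, rfl⟩ := (Scheme.ΓSpecIso R).symm.commRingCatIsoToRingEquiv.surjective y
    exact congrArg _ (h hxy)
  rw [this]
  exact Scheme.IdealSheafData.ext_of_isAffine (by simp)

lemma SchemeTheoreticallyDominantAfter.specMap {A R S B : Type u} [CommRing A] [CommRing R]
    [CommRing S] [CommRing B] [Algebra A R] [Algebra A S] [Algebra R S] [IsScalarTower A R S]
    [Algebra A B] (h : Function.Injective ((IsScalarTower.toAlgHom A R S).toLinearMap.rTensor B)) :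
    SchemeTheoreticallyDominantAfter (Spec.map (CommRingCat.ofHom (algebraMap R S)))
      (Spec.map (CommRingCat.ofHom (algebraMap A R)))
      (Spec.map (CommRingCat.ofHom (algebraMap A B))) := by
  intro X' Z' x z h' p' h₁ h₂
  have hR := isPullback_SpecMap_of_isPushout _ _ _ _ (CommRingCat.isPushout_tensorProduct A R B)
  have hS := isPullback_SpecMap_of_isPushout _ _ _ _ (CommRingCat.isPushout_tensorProduct A S B)
  rw [IsScalarTower.algebraMap_eq A R S, CommRingCat.ofHom_comp, Spec.map_comp] at hS
  let φ : R ⊗[A] B →+* S ⊗[A] B :=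
    (Algebra.TensorProduct.map (IsScalarTower.toAlgHom A R S) (AlgHom.id A B)).toRingHom
  have hφ : Function.Injective φ := h
  have := IsSchemeTheoreticallyDominant.specMap (CommRingCat.ofHom φ) hφ
  let eX := (h₁.paste_vert h₂).isoIsPullback _ _ hS
  let eZ := h₂.isoIsPullback _ _ hR
  have key : h' = eX.hom ≫ Spec.map (CommRingCat.ofHom φ) ≫ eZ.inv := by
    rw [← Category.assoc, Iso.eq_comp_inv]
    refine hR.hom_ext ?_ ?_
    · have : CommRingCat.ofHom (Algebra.TensorProduct.includeLeftRingHom (R := A) (A := R) (B := B)) ≫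
          CommRingCat.ofHom φ = CommRingCat.ofHom (algebraMap R S) ≫
          CommRingCat.ofHom (Algebra.TensorProduct.includeLeftRingHom (R := A) (A := S) (B := B)) := by
        ext r
        simp [φ]
      rw [Category.assoc, Category.assoc, ← Spec.map_comp, this, Spec.map_comp]
      simp [eX, eZ, h₁.w]
    · have : CommRingCat.ofHom (Algebra.TensorProduct.includeRight (R := A) (A := R) (B := B)).toRingHom ≫
          CommRingCat.ofHom φ =
          CommRingCat.ofHom (Algebra.TensorProduct.includeRight (R := A) (A := S) (B := B)).toRingHom := by
        ext r
        simp [φ]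
      rw [Category.assoc, Category.assoc, ← Spec.map_comp, this]
      simp [eX, eZ]
  rw [key]
  infer_instance

lemma SchemeTheoreticallyDominantAfter.of_openCover_target {X Z S T : Scheme.{u}} {h : X ⟶ Z}
    {p : Z ⟶ S} {t : T ⟶ S} (𝒱 : Z.OpenCover)
    (H : ∀ j, ∃ (V : Scheme.{u}) (w : V ⟶ X) (g : V ⟶ 𝒱.X j), g ≫ 𝒱.f j = w ≫ h ∧
      SchemeTheoreticallyDominantAfter g (𝒱.f j ≫ p) t) :
    SchemeTheoreticallyDominantAfter h p t := by
  intro X' Z' x z h' p' h₁ h₂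
  refine .of_openCover h' (𝒱.pullback₁ z) fun j => ?_
  obtain ⟨V, w, g, hg, hV⟩ := H j
  have hP := (IsPullback.of_hasPullback z (𝒱.f j)).flip
  have hQ := IsPullback.of_hasPullback g (pullback.snd z (𝒱.f j))
  refine ⟨pullback g (pullback.snd z (𝒱.f j)), h₁.lift (pullback.fst _ _ ≫ w)
    (pullback.snd _ _ ≫ pullback.fst z (𝒱.f j)) ?_, pullback.snd _ _, ?_, ?_⟩
  · rw [Category.assoc, ← hg, Category.assoc, pullback.condition, pullback.condition_assoc]
  · exact (h₁.lift_snd _ _ _).symm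
  · exact hV _ _ _ _ hQ (hP.paste_vert h₂)

lemma SchemeTheoreticallyDominantAfter.of_openCover_base {X Z S T : Scheme.{u}} {h : X ⟶ Z}
    {p : Z ⟶ S} {t : T ⟶ S} (𝒯 : T.OpenCover)
    (H : ∀ k, SchemeTheoreticallyDominantAfter h p (𝒯.f k ≫ t)) :
    SchemeTheoreticallyDominantAfter h p t := by
  intro X' Z' x z h' p' h₁ h₂
  refine .of_openCover h' (𝒯.pullback₁ p') fun k => ?_
  have hP := IsPullback.of_hasPullback p' (𝒯.f k)
  have hQ := IsPullback.of_hasPullback h' (pullback.fst p' (𝒯.f k))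
  exact ⟨_, pullback.fst h' (pullback.fst p' (𝒯.f k)), pullback.snd _ _, pullback.condition.symm,
    H k _ _ _ _ (hQ.paste_horiz h₁) (hP.paste_horiz h₂)⟩

/-- A quasi-compact scheme is covered by finitely many non-empty affine open subschemes. -/
lemma exists_finite_affine_charts (Z : Scheme.{u}) [CompactSpace Z] :
    ∃ (ι : Type u) (_ : Finite ι) (R : ι → CommRingCat.{u}) (v : ∀ i, Spec (R i) ⟶ Z),
      (∀ i, IsOpenImmersion (v i)) ∧ (∀ i, Nonempty (Spec (R i))) ∧ ∀ z, ∃ i y, v i y = z := by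
  let 𝒰 := Z.affineOpenCover
  obtain ⟨t, -, ht⟩ := isCompact_univ.elim_nhds_subcover
    (fun x : Z => Set.range (𝒰.f (𝒰.idx x)))
    fun x _ => (𝒰.f (𝒰.idx x)).opensRange.isOpen.mem_nhds (𝒰.covers x)
  refine ⟨t, inferInstance, fun x => 𝒰.X (𝒰.idx x.1), fun x => 𝒰.f (𝒰.idx x.1),
    fun x => inferInstance, fun x => ?_, fun z => ?_⟩
  · obtain ⟨y, -⟩ := 𝒰.covers x.1
    exact ⟨y⟩
  · obtain ⟨x, hx, y, hy⟩ := Set.mem_iUnion₂.mp (ht (Set.mem_univ z))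
    exact ⟨⟨x, hx⟩, y, hy⟩

section

variable {A : Type u} [CommRing A] [IsDomain A] [IsNoetherianRing A] {X Z : Scheme.{u}}

/-- Any non-empty affine open Spec S of the preimage of Spec R is dense in the integral scheme X,
hence dominates Spec R. As R is a domain, R → S is injective, and generic universal injectivity
applies. -/
lemma exists_schemeTheoreticallyDominantAfter_chart (h : X ⟶ Z) (p : Z ⟶ Spec (.of A))
    [IsIntegral X] [IsIntegral Z] [IsDominant h] [LocallyOfFiniteType p]
    [LocallyOfFiniteType (h ≫ p)] {R : CommRingCat.{u}} (v : Spec R ⟶ Z) [IsOpenImmersion v]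
    [Nonempty (Spec R)] :
    ∃ (V : Scheme.{u}) (w : V ⟶ X) (g : V ⟶ Spec R), g ≫ v = w ≫ h ∧ ∃ s : A, s ≠ 0 ∧
      ∀ (B : CommRingCat.{u}) (φ : .of A ⟶ B), IsUnit (φ s) →
        SchemeTheoreticallyDominantAfter g (v ≫ p) (Spec.map φ) := by
  have : IsIntegral (Spec R) := isIntegral_of_isOpenImmersion v
  have : IsDomain R := (affine_isIntegral_iff R).mp this
  obtain ⟨x, hx⟩ : ∃ x, h x ∈ v.opensRange :=
    h.denseRange.exists_mem_open v.opensRange.isOpen (Set.range_nonempty v)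
  let P := pullback h v
  obtain ⟨y, hy⟩ : ∃ y : P, (pullback.fst h v) y = x := by
    have : x ∈ Set.range (pullback.fst h v) := by
      rw [Scheme.Pullback.range_fst]
      exact hx
    exact this
  let S := P.affineOpenCover.X (P.affineOpenCover.idx y)
  let c : Spec S ⟶ P := P.affineOpenCover.f _
  obtain ⟨y', hy'⟩ : y ∈ Set.range c := P.affineOpenCover.covers y
  have : Nonempty (Spec S) := ⟨y'⟩
  let w : Spec S ⟶ X := c ≫ pullback.fst h v
  have : IsIntegral (Spec S) := isIntegral_of_isOpenImmersion w
  have : IsDominant w := ⟨(w.opensRange.isOpen.dense (Set.range_nonempty w))⟩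
  obtain ⟨ψ, hψ⟩ := Spec.map_surjective (c ≫ pullback.snd h v)
  have hcomm : Spec.map ψ ≫ v = w ≫ h := by rw [hψ]; simp [w, pullback.condition]
  have : IsDominant (Spec.map ψ ≫ v) := hcomm ▸ inferInstance
  have : IsDominant (Spec.map ψ) := .of_comp_of_isOpenImmersion _ v
  have hinj : Function.Injective ψ.hom := by
    have := (PrimeSpectrum.denseRange_comap_iff_ker_le_nilRadical ψ.hom).mp
      (Spec.map ψ).denseRange
    rw [RingHom.injective_iff_ker_eq_bot, eq_bot_iff]
    simpa using this
  obtain ⟨α, hα⟩ := Spec.map_surjective (v ≫ p)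
  have h1 : α.hom.FiniteType := by
    have : LocallyOfFiniteType (Spec.map α) := hα ▸ inferInstance
    exact HasRingHomProperty.Spec_iff.mp this
  have h2 : (α ≫ ψ).hom.FiniteType := by
    have : LocallyOfFiniteType (Spec.map (α ≫ ψ)) := by
      rw [Spec.map_comp, hα, ← Category.assoc, hcomm, Category.assoc]
      infer_instance
    exact HasRingHomProperty.Spec_iff.mp this
  algebraize [α.hom, ψ.hom, (α ≫ ψ).hom]
  have : IsScalarTower A R S := .of_algebraMap_eq fun _ => rfl
  obtain ⟨s, hs, H⟩ := GenericFlatness.exists_rTensor_injective A R S hinj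
  refine ⟨Spec S, w, Spec.map ψ, hcomm, s, hs, fun B φ hφ => ?_⟩
  algebraize [φ.hom]
  have := SchemeTheoreticallyDominantAfter.specMap (H B hφ)
  rw [← hα]
  exact this

/-- A dominant morphism of integral schemes of finite type over a Noetherian domain
becomes universally scheme-theoretically dominant over a non-empty open subset of the base. -/
theorem exists_schemeTheoreticallyDominantAfter (h : X ⟶ Z) (p : Z ⟶ Spec (.of A))
    [IsIntegral X] [IsIntegral Z] [IsDominant h] [QuasiCompact p] [LocallyOfFiniteType p]
    [LocallyOfFiniteType (h ≫ p)] :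
    ∃ s : A, s ≠ 0 ∧ ∀ (B : CommRingCat.{u}) (φ : .of A ⟶ B), IsUnit (φ s) →
      ∀ (T : Scheme.{u}) (t : T ⟶ Spec B),
        SchemeTheoreticallyDominantAfter h p (t ≫ Spec.map φ) := by
  have : CompactSpace Z := QuasiCompact.compactSpace_of_compactSpace p
  obtain ⟨ι, _, R, v, hv, hne, hcov⟩ := exists_finite_affine_charts Z
  choose V w g hg s hs H using fun j : ι =>
    exists_schemeTheoreticallyDominantAfter_chart h p (v j)
  let _ : Fintype ι := Fintype.ofFinite _
  refine ⟨∏ j, s j, Finset.prod_ne_zero_iff.mpr fun j _ => hs j, fun B φ hφ T t => ?_⟩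
  replace hφ (j : ι) : IsUnit (φ (s j)) := by
    rw [map_prod] at hφ
    exact isUnit_of_dvd_unit (Finset.dvd_prod_of_mem (fun j => φ (s j)) (Finset.mem_univ j)) hφ
  -- On an affine piece of T the base change is given by an A-algebra in which every `s j` is a
  -- unit.
  refine .of_openCover_base T.affineOpenCover.openCover fun k => ?_
  refine .of_openCover_target
    (Scheme.Cover.mkOfCovers ι (fun i => Spec (R i)) v hcov (fun i => hv i)) fun j => ?_
  refine ⟨V j, w j, g j, hg j, ?_⟩
  obtain ⟨ψ, hψ⟩ := Spec.map_surjective (T.affineOpenCover.f k ≫ t)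
  have e : T.affineOpenCover.f k ≫ t ≫ Spec.map φ = Spec.map (φ ≫ ψ) := by
    rw [Spec.map_comp, hψ, Category.assoc]
  change SchemeTheoreticallyDominantAfter (g j) (v j ≫ p) (T.affineOpenCover.f k ≫ t ≫ Spec.map φ)
  rw [e]
  exact H j _ (φ ≫ ψ) ((hφ j).map ψ.hom)

/-- Generic flatness for schemes of finite type over a Noetherian domain. -/
theorem exists_flat_of_isPullback (p : Z ⟶ Spec (.of A)) [QuasiCompact p]
    [LocallyOfFiniteType p] :
    ∃ s : A, s ≠ 0 ∧ ∀ (B : CommRingCat.{u}) (φ : .of A ⟶ B), IsUnit (φ s) →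
      ∀ ⦃Z' : Scheme.{u}⦄ (z : Z' ⟶ Z) (p' : Z' ⟶ Spec B), IsPullback z p' p (Spec.map φ) →
        Flat p' := by
  have : CompactSpace Z := QuasiCompact.compactSpace_of_compactSpace p
  obtain ⟨ι, _, R, v, hv, -, hcov⟩ := exists_finite_affine_charts Z
  have key (j : ι) : ∃ s : A, s ≠ 0 ∧ ∀ (B : CommRingCat.{u}) (φ : .of A ⟶ B), IsUnit (φ s) →
      ∀ ⦃Z' : Scheme.{u}⦄ (z : Z' ⟶ Spec (R j)) (p' : Z' ⟶ Spec B),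
        IsPullback z p' (v j ≫ p) (Spec.map φ) → Flat p' := by
    obtain ⟨α, hα⟩ := Spec.map_surjective (v j ≫ p)
    have h1 : α.hom.FiniteType := by
      have : LocallyOfFiniteType (Spec.map α) := hα ▸ inferInstance
      exact HasRingHomProperty.Spec_iff.mp this
    algebraize [α.hom]
    obtain ⟨s, hs, hflat⟩ :=
      (GenericFlatness.genericFlatnessHolds_of_finiteType A (R j)
        (R j)).exists_flat_away
    refine ⟨s, hs, fun B φ hφ Z' z p' hz => ?_⟩
    algebraize [φ.hom]
    have hB := GenericFlatness.flat_baseChange_of_flat_away (M := R j) (s := s) B hφ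
    have hR := isPullback_SpecMap_of_isPushout _ _ _ _
      (CommRingCat.isPushout_tensorProduct A (R j) B)
    rw [← hα] at hz
    have e := hz.isoIsPullback_hom_snd _ _ hR
    suffices Flat (Spec.map (CommRingCat.ofHom (Algebra.TensorProduct.includeRight (R := A)
        (A := R j) (B := B)).toRingHom)) by
      rw [← e]
      infer_instance
    rw [Flat.SpecMap_iff]
    change RingHom.Flat (Algebra.TensorProduct.includeRight (R := A) (A := R j) (B := B)).toRingHom
    have hc : (Algebra.TensorProduct.includeRight (R := A) (A := R j) (B := B)).toRingHom =
        (Algebra.TensorProduct.comm A B (R j)).toRingEquiv.toRingHom.comp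
          (algebraMap B ((B : Type u) ⊗[A] R j)) := by
      ext b
      simp [Algebra.TensorProduct.algebraMap_apply]
    rw [hc]
    exact RingHom.Flat.comp (RingHom.flat_algebraMap_iff.mpr hB)
      (.of_bijective (Algebra.TensorProduct.comm A B (R j)).bijective)
  choose s hs H using key
  have : Fintype ι := Fintype.ofFinite _
  refine ⟨∏ j, s j, Finset.prod_ne_zero_iff.mpr fun j _ => hs j, fun B φ hφ Z' z p' hz => ?_⟩
  replace hφ (j : ι) : IsUnit (φ (s j)) := by
    rw [map_prod] at hφ
    exact isUnit_of_dvd_unit (Finset.dvd_prod_of_mem (fun j => φ (s j)) (Finset.mem_univ j)) hφ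
  let 𝒱 : Z.OpenCover :=
    Scheme.Cover.mkOfCovers ι (fun i => Spec (R i)) v hcov (fun i => hv i)
  have : IsZariskiLocalAtSource @Flat.{u} := HasRingHomProperty.instIsZariskiLocalAtSource
  refine (IsZariskiLocalAtSource.iff_of_openCover (P := @Flat.{u}) (𝒱.pullback₁ z)).mpr fun j => ?_
  exact H j B φ (hφ j) _ _
    ((IsPullback.of_hasPullback z (v j)).flip.paste_vert hz)

end

end AlgebraicGeometry

/-! ### Ultraproducts of rings, valuation rings and fields -/

section

variable {ι : Type u} (U : Ultrafilter ι) (R : ι → Type u) [∀ i, CommRing (R i)]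

/-- The ideal of the families that vanish almost everywhere with respect to an ultrafilter. -/
def Ultrafilter.zeroIdeal : Ideal (∀ i, R i) where
  carrier := {f | ∀ᶠ i in U, f i = 0}
  zero_mem' := by simp
  add_mem' := fun {f g} hf hg => by
    filter_upwards [hf, hg] with i h₁ h₂
    simp [h₁, h₂]
  smul_mem' := fun c f hf => by
    filter_upwards [hf] with i h
    simp [h]

/-- The ultraproduct of a family of commutative rings. -/
abbrev Ultraproduct : Type u := (∀ i, R i) ⧸ U.zeroIdeal R

namespace Ultraproduct

variable {U R}

lemma mk_eq_mk_iff {f g : ∀ i, R i} :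
    Ideal.Quotient.mk (U.zeroIdeal R) f = Ideal.Quotient.mk (U.zeroIdeal R) g ↔
      ∀ᶠ i in U, f i = g i := by
  rw [Ideal.Quotient.mk_eq_mk_iff_sub_mem]
  change (∀ᶠ i in U, f i - g i = 0) ↔ _
  simp only [sub_eq_zero]

lemma mk_eq_zero_iff {f : ∀ i, R i} :
    Ideal.Quotient.mk (U.zeroIdeal R) f = 0 ↔ ∀ᶠ i in U, f i = 0 := by
  rw [← map_zero (Ideal.Quotient.mk (U.zeroIdeal R)), mk_eq_mk_iff]
  rfl

instance isDomain [∀ i, IsDomain (R i)] : IsDomain (Ultraproduct U R) := by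
  have : Nontrivial (Ultraproduct U R) := by
    refine ⟨0, 1, fun h => ?_⟩
    rw [← map_one (Ideal.Quotient.mk (U.zeroIdeal R)), eq_comm, mk_eq_zero_iff] at h
    obtain ⟨i, hi⟩ := h.exists
    exact one_ne_zero hi
  have : NoZeroDivisors (Ultraproduct U R) := by
    refine ⟨fun {a b} h => ?_⟩
    obtain ⟨a, rfl⟩ := Ideal.Quotient.mk_surjective a
    obtain ⟨b, rfl⟩ := Ideal.Quotient.mk_surjective b
    rw [← map_mul, mk_eq_zero_iff] at h
    rw [mk_eq_zero_iff, mk_eq_zero_iff, ← Ultrafilter.eventually_or]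
    filter_upwards [h] with i hi
    exact mul_eq_zero.mp hi
  exact NoZeroDivisors.to_isDomain _

/-- At each index one of the two entries divides the other; the ultrafilter decides which
alternative holds almost everywhere. -/
instance valuationRing [∀ i, IsDomain (R i)] [∀ i, ValuationRing (R i)] :
    ValuationRing (Ultraproduct U R) where
  cond' a b := by
    obtain ⟨a, rfl⟩ := Ideal.Quotient.mk_surjective a
    obtain ⟨b, rfl⟩ := Ideal.Quotient.mk_surjective b
    choose c hc using fun i => ValuationRing.cond (a i) (b i)
    refine ⟨Ideal.Quotient.mk _ c, ?_⟩
    rw [← map_mul, ← map_mul, mk_eq_mk_iff, mk_eq_mk_iff, ← Ultrafilter.eventually_or]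
    exact .of_forall hc

instance isMaximal (K : ι → Type u) [∀ i, Field (K i)] : (U.zeroIdeal K).IsMaximal := by
  rw [Ideal.isMaximal_iff]
  refine ⟨fun h => ?_, fun J x hJ hx hxJ => ?_⟩
  · obtain ⟨i, hi⟩ := (mk_eq_zero_iff.mp (Ideal.Quotient.eq_zero_iff_mem.mpr h)).exists
    exact one_ne_zero hi
  · have h1 : ∀ᶠ i in U, x i ≠ 0 := by
      rw [← Ideal.Quotient.eq_zero_iff_mem, mk_eq_zero_iff] at hx
      exact Ultrafilter.eventually_not.mpr hx
    have h2 : x * x⁻¹ - 1 ∈ U.zeroIdeal K := by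
      rw [← Ideal.Quotient.mk_eq_mk_iff_sub_mem, mk_eq_mk_iff]
      filter_upwards [h1] with i hi
      simp [hi]
    simpa using J.sub_mem (J.mul_mem_right x⁻¹ hxJ) (hJ h2)

noncomputable instance field (K : ι → Type u) [∀ i, Field (K i)] : Field (Ultraproduct U K) :=
  Ideal.Quotient.field _

section

variable {S : ι → Type u} [∀ i, CommRing (S i)]

/-- The map of ultraproducts induced by a family of ring homomorphisms. -/
def map (φ : ∀ i, R i →+* S i) : Ultraproduct U R →+* Ultraproduct U S :=
  Ideal.quotientMap _ (RingHom.pi fun i => (φ i).comp (Pi.evalRingHom R i)) fun f hf => by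
    rw [Ideal.mem_comap, ← Ideal.Quotient.eq_zero_iff_mem, mk_eq_zero_iff]
    rw [← Ideal.Quotient.eq_zero_iff_mem, mk_eq_zero_iff] at hf
    filter_upwards [hf] with i hi
    change φ i (f i) = 0
    rw [hi, map_zero]

lemma map_mk (φ : ∀ i, R i →+* S i) (f : ∀ i, R i) :
    map (U := U) φ (Ideal.Quotient.mk _ f) = Ideal.Quotient.mk _ fun i => φ i (f i) := rfl

end

noncomputable instance (K : ι → Type u) [∀ i, Field (K i)] [∀ i, Algebra (R i) (K i)] :
    Algebra (Ultraproduct U R) (Ultraproduct U K) :=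
  (map fun i => algebraMap (R i) (K i)).toAlgebra

lemma algebraMap_eq (K : ι → Type u) [∀ i, Field (K i)] [∀ i, Algebra (R i) (K i)] :
    algebraMap (Ultraproduct U R) (Ultraproduct U K) = map fun i => algebraMap (R i) (K i) := rfl

/-- Together with `valuationRing`, this lets a family of valuative squares be merged into a single
one. -/
instance isFractionRing [∀ i, IsDomain (R i)] (K : ι → Type u) [∀ i, Field (K i)]
    [∀ i, Algebra (R i) (K i)] [∀ i, IsFractionRing (R i) (K i)] :
    IsFractionRing (Ultraproduct U R) (Ultraproduct U K) := by
  have : FaithfulSMul (Ultraproduct U R) (Ultraproduct U K) := by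
    rw [faithfulSMul_iff_algebraMap_injective, injective_iff_map_eq_zero]
    intro a ha
    obtain ⟨a, rfl⟩ := Ideal.Quotient.mk_surjective a
    rw [algebraMap_eq, map_mk, mk_eq_zero_iff] at ha
    rw [mk_eq_zero_iff]
    filter_upwards [ha] with i hi
    exact (map_eq_zero_iff _ (IsFractionRing.injective (R i) (K i))).mp hi
  refine IsFractionRing.of_field _ _ fun z => ?_
  obtain ⟨z, rfl⟩ := Ideal.Quotient.mk_surjective z
  choose x y hy hz using fun i => IsFractionRing.div_surjective (A := R i) (z i)
  refine ⟨Ideal.Quotient.mk _ x, Ideal.Quotient.mk _ y, ?_⟩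
  rw [eq_div_iff, algebraMap_eq, map_mk, map_mk, ← map_mul, mk_eq_mk_iff]
  · refine .of_forall fun i => ?_
    rw [Pi.mul_apply, ← hz, div_mul_cancel₀]
    exact IsFractionRing.to_map_ne_zero_of_mem_nonZeroDivisors (hy i)
  · rw [algebraMap_eq, map_mk, Ne, mk_eq_zero_iff]
    intro h
    obtain ⟨i, hi⟩ := h.exists
    exact IsFractionRing.to_map_ne_zero_of_mem_nonZeroDivisors (hy i) hi

open Classical in
/-- The canonical map from a partial product over a large set to the ultraproduct. -/
noncomputable def ofProd (J : Set ι) (hJ : J ∈ U) : (∀ i : J, R i) →+* Ultraproduct U R where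
  -- The default value is immaterial: the complement of J is negligible.
  toFun f := Ideal.Quotient.mk _ fun i => if h : i ∈ J then f ⟨i, h⟩ else 0
  map_one' := by
    rw [← map_one (Ideal.Quotient.mk (U.zeroIdeal R)), mk_eq_mk_iff]
    filter_upwards [hJ] with i hi
    simp [hi]
  map_mul' f g := by
    rw [← map_mul, mk_eq_mk_iff]
    filter_upwards [hJ] with i hi
    simp [hi]
  map_zero' := by
    rw [mk_eq_zero_iff]
    filter_upwards [hJ] with i hi
    simp [hi]
  map_add' f g := by
    rw [← map_add, mk_eq_mk_iff]
    filter_upwards [hJ] with i hi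
    simp [hi]

variable (R) in
/-- The restriction of a family to a subset of the index set. -/
def restr (J : Set ι) : (∀ i, R i) →+* ∀ i : J, R i := RingHom.pi fun i => Pi.evalRingHom R i

variable (R) in
/-- The restriction of a family to a subset of the index set. -/
def restrOfLE {J J' : Set ι} (h : J' ⊆ J) : (∀ i : J, R i) →+* ∀ i : J', R i :=
  RingHom.pi fun i => Pi.evalRingHom (fun i : J => R i) ⟨i, h i.2⟩

lemma ofProd_comp_restr (J : Set ι) (hJ : J ∈ U) :
    (ofProd J hJ).comp (restr R J) = Ideal.Quotient.mk (U.zeroIdeal R) := by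
  ext f
  refine mk_eq_mk_iff.mpr ?_
  filter_upwards [hJ] with i hi
  simp [restr, hi]

lemma ofProd_comp_restrOfLE {J J' : Set ι} (h : J' ⊆ J) (hJ' : J' ∈ U) (hJ : J ∈ U) :
    (ofProd J' hJ').comp (restrOfLE R h) = ofProd J hJ := by
  ext f
  refine mk_eq_mk_iff.mpr ?_
  filter_upwards [hJ'] with i hi
  simp [restrOfLE, hi, h hi]

lemma restr_surjective (J : Set ι) : Function.Surjective (restr R J) := by
  classical
  intro f
  refine ⟨fun i => if h : i ∈ J then f ⟨i, h⟩ else 0, ?_⟩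
  ext i
  simp [restr]

end Ultraproduct

end

/-! ### The ultraproduct as a filtered colimit of partial products -/

namespace Ultraproduct

variable {ι : Type u} (U : Ultrafilter ι) (R : ι → Type u) [∀ i, CommRing (R i)]

/-- The system of the partial products over the large sets of an ultrafilter. -/
noncomputable def prodDiagram : {J : Set ι // J ∈ U}ᵒᵖ ⥤ CommRingCat.{u} where
  obj J := .of (∀ i : J.unop.1, R i)
  map h := CommRingCat.ofHom (restrOfLE R h.unop.le)

/-- The ultraproduct as a cocone over the partial products. -/
noncomputable def prodCocone : Cocone (prodDiagram U R) where
  pt := .of (Ultraproduct U R)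
  ι :=
    { app := fun J => CommRingCat.ofHom (ofProd J.unop.1 J.unop.2)
      naturality := fun J J' h => by
        have := ofProd_comp_restrOfLE (R := R) h.unop.le J'.unop.2 J.unop.2
        exact congrArg CommRingCat.ofHom this }

/-- The ultraproduct is the colimit of the partial products over the large sets. -/
noncomputable def isColimitProdCocone : IsColimit (prodCocone U R) := by
  classical
  let t : {J : Set ι // J ∈ U} := ⟨Set.univ, Filter.univ_mem⟩
  -- Restriction from the full product is surjective, so a cocone is determined by its leg at the
  -- full index set.
  have key (s : Cocone (prodDiagram U R)) (J : {J : Set ι // J ∈ U}) (f : ∀ i, R i) :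
      (s.ι.app (.op J)).hom (restr R J.1 f) = (s.ι.app (.op t)).hom (restr R Set.univ f) := by
    have h : J ≤ t := Set.subset_univ _
    exact (ConcreteCategory.congr_hom (s.w (homOfLE h).op) (restr R Set.univ f))
  let desc (s : Cocone (prodDiagram U R)) : Ultraproduct U R →+* s.pt :=
    Ideal.Quotient.lift (U.zeroIdeal R)
      ((s.ι.app (.op t)).hom.comp (restr R Set.univ)) fun f hf => by
        rw [← Ideal.Quotient.eq_zero_iff_mem, mk_eq_zero_iff] at hf
        have : restr R {i | f i = 0} f = 0 := by
          ext i
          exact i.2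
        exact (key s ⟨_, hf⟩ f).symm.trans ((congrArg _ this).trans (map_zero _))
  refine
    { desc := fun s => CommRingCat.ofHom (desc s)
      fac := fun s J => ?_
      uniq := fun s m hm => ?_ }
  · ext f
    obtain ⟨f, rfl⟩ := restr_surjective J.unop.1 f
    have h := RingHom.congr_fun (ofProd_comp_restr (R := R) J.unop.1 J.unop.2) f
    exact (congrArg (desc s) h).trans (key s J.unop f).symm
  · refine CommRingCat.hom_ext (Ideal.Quotient.ringHom_ext (RingHom.ext fun f => ?_))
    have h := RingHom.congr_fun (ofProd_comp_restr (R := R) t.1 t.2) f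
    have h' := ConcreteCategory.congr_hom (hm (.op t)) (restr R Set.univ f)
    exact Eq.trans (congrArg m.hom h.symm) h'

instance : IsCofiltered {J : Set ι // J ∈ U} := by
  have : Nonempty {J : Set ι // J ∈ U} := ⟨⟨Set.univ, Filter.univ_mem⟩⟩
  have : IsCodirectedOrder {J : Set ι // J ∈ U} :=
    ⟨fun J J' => ⟨⟨J.1 ∩ J'.1, Filter.inter_mem J.2 J'.2⟩, Set.inter_subset_left,
      Set.inter_subset_right⟩⟩
  exact isCofiltered_of_directed_ge_nonempty _

/-- The system of the spectra of the partial products over the large sets of an ultrafilter. -/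
noncomputable abbrev specDiagram : {J : Set ι // J ∈ U} ⥤ Scheme.{u} :=
  (prodDiagram U R).rightOp ⋙ Scheme.Spec

/-- The spectrum of the ultraproduct as a cone over the spectra of the partial products. -/
noncomputable abbrev specCone : Cone (specDiagram U R) :=
  Scheme.Spec.mapCone (coneRightOpOfCocone (prodCocone U R))

/-- The spectrum of the ultraproduct is the limit of the spectra of the partial products. -/
noncomputable def isLimitSpecCone : IsLimit (specCone U R) :=
  isLimitOfPreserves Scheme.Spec (isLimitConeRightOpOfCocone _ (isColimitProdCocone U R))

variable {U R} {Z S : Scheme.{u}} (p : Z ⟶ S) (τ : Spec (.of (∀ i, R i)) ⟶ S)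

variable (U) in
/-- The morphism of the system of partial products to `S` given by a morphism on the spectrum of
the product. -/
noncomputable def specDiagramHom : specDiagram U R ⟶ (Functor.const _).obj S where
  app J := Spec.map (CommRingCat.ofHom (restr R J.1)) ≫ τ
  naturality J J' h := by
    have : Spec.map (CommRingCat.ofHom (restrOfLE R h.le)) ≫
        Spec.map (CommRingCat.ofHom (restr R J'.1)) ≫ τ =
        Spec.map (CommRingCat.ofHom (restr R J.1)) ≫ τ := by
      rw [← Category.assoc, ← Spec.map_comp]
      rfl
    exact this.trans (Category.comp_id _).symm

/-- The spectrum of the ultraproduct is a limit of affine schemes, so a point of a scheme locally of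
finite presentation is already defined at a finite stage, over a large set J. -/
lemma exists_ofProd_comp_eq [LocallyOfFinitePresentation p]
    (l : Spec (.of (Ultraproduct U R)) ⟶ Z)
    (hl : l ≫ p = Spec.map (CommRingCat.ofHom (Ideal.Quotient.mk _)) ≫ τ) :
    ∃ (J : Set ι) (hJ : J ∈ U) (g : Spec (.of (∀ i : J, R i)) ⟶ Z),
      Spec.map (CommRingCat.ofHom (ofProd J hJ)) ≫ g = l ∧
        g ≫ p = Spec.map (CommRingCat.ofHom (restr R J)) ≫ τ := by
  have (J : {J : Set ι // J ∈ U}) : IsAffine ((specDiagram U R).obj J) :=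
    inferInstanceAs (IsAffine (Spec _))
  obtain ⟨J, g, h₁, h₂⟩ := Scheme.exists_π_app_comp_eq_of_locallyOfFinitePresentation
    (specDiagram U R) (specDiagramHom U τ) p (specCone U R) (isLimitSpecCone U R) l (by
      ext J
      change Spec.map (CommRingCat.ofHom (ofProd J.1 J.2)) ≫
        Spec.map (CommRingCat.ofHom (restr R J.1)) ≫ τ = l ≫ p
      rw [hl, ← Category.assoc, ← Spec.map_comp, ← ofProd_comp_restr J.1 J.2]
      rfl)
  exact ⟨J.1, J.2, g, h₁, h₂⟩

/-- Two morphisms that agree in the limit agree on the product over some large subset, hence at each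
of its coordinates. -/
lemma eventually_evalRingHom_comp_eq [LocallyOfFiniteType p] {J : Set ι} (hJ : J ∈ U)
    (a b : Spec (.of (∀ i : J, R i)) ⟶ Z)
    (ha : a ≫ p = Spec.map (CommRingCat.ofHom (restr R J)) ≫ τ)
    (hb : b ≫ p = Spec.map (CommRingCat.ofHom (restr R J)) ≫ τ)
    (hab : Spec.map (CommRingCat.ofHom (ofProd J hJ)) ≫ a =
      Spec.map (CommRingCat.ofHom (ofProd J hJ)) ≫ b) :
    ∀ᶠ i in U, ∀ hi : i ∈ J,
      Spec.map (CommRingCat.ofHom (Pi.evalRingHom (fun i : J => R i) ⟨i, hi⟩)) ≫ a =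
        Spec.map (CommRingCat.ofHom (Pi.evalRingHom (fun i : J => R i) ⟨i, hi⟩)) ≫ b := by
  have (J : {J : Set ι // J ∈ U}) : IsAffine ((specDiagram U R).obj J) :=
    inferInstanceAs (IsAffine (Spec _))
  obtain ⟨J', h, h', H⟩ := Scheme.exists_hom_hom_comp_eq_comp_of_locallyOfFiniteType
    (specDiagram U R) (specDiagramHom U τ) p (specCone U R) (isLimitSpecCone U R)
    (i := ⟨J, hJ⟩) a ha.symm (j := ⟨J, hJ⟩) b hb.symm hab
  replace H : Spec.map (CommRingCat.ofHom (restrOfLE R h.le)) ≫ a =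
    Spec.map (CommRingCat.ofHom (restrOfLE R h.le)) ≫ b := H
  filter_upwards [J'.2] with i hi' hi
  have e : Spec.map (CommRingCat.ofHom (Pi.evalRingHom (fun i : J => R i) ⟨i, hi⟩)) =
      Spec.map (CommRingCat.ofHom (Pi.evalRingHom (fun i : J'.1 => R i) ⟨i, hi'⟩)) ≫
        Spec.map (CommRingCat.ofHom (restrOfLE R h.le)) := by
    rw [← Spec.map_comp]
    rfl
  rw [e, Category.assoc, H, Category.assoc]

end Ultraproduct

/-! ### Spreading out properness from k to a subalgebra of finite type -/

namespace SchemeRealization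

variable {k : Type u} [Field k]

instance : IsDirectedOrder (FGSub k) :=
  ⟨fun A B => ⟨⟨A.1 ⊔ B.1, A.2.sup B.2⟩, (le_sup_left : A.1 ≤ A.1 ⊔ B.1),
    (le_sup_right : B.1 ≤ A.1 ⊔ B.1)⟩⟩

lemma exists_le_mem (A : FGSub k) (x : k) : ∃ B : FGSub k, A ≤ B ∧ x ∈ B.1 := by
  let C : FGSub k := ⟨Algebra.adjoin ℤ {x}, by
    simpa using Subalgebra.fg_adjoin_finset (R := ℤ) ({x} : Finset k)⟩
  obtain ⟨B, hA, hC⟩ := exists_ge_ge A C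
  exact ⟨B, hA, hC (Algebra.self_mem_adjoin_singleton ℤ x)⟩

instance (A : FGSub k) : IsDirectedOrder {B : FGSub k // A ≤ B} :=
  ⟨fun B C => by
    obtain ⟨D, hB, hC⟩ := exists_ge_ge B.1 C.1
    exact ⟨⟨D, B.2.trans hB⟩, hB, hC⟩⟩

instance (A : FGSub k) : Nonempty {B : FGSub k // A ≤ B} := ⟨⟨A, le_rfl⟩⟩

/-- An ultrafilter on the subalgebras containing `A` that is finer than the order filter. -/
noncomputable def ultrafilterAbove (A : FGSub k) : Ultrafilter {B : FGSub k // A ≤ B} :=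
  Ultrafilter.of Filter.atTop

lemma eventually_mem (A : FGSub k) (x : k) : ∀ᶠ B in (ultrafilterAbove A : Filter {B : FGSub k // A ≤ B}), x ∈ B.1.1 := by
  obtain ⟨B, hB, hx⟩ := exists_le_mem A x
  refine Ultrafilter.of_le Filter.atTop ?_
  filter_upwards [Filter.eventually_ge_atTop ⟨B, hB⟩] with C hC
  exact hC hx

lemma fromSub_comp_fromSub {A B C : FGSub k} (h : A ≤ B) (h' : B ≤ C) :
    fromSub h' ≫ fromSub h = fromSub (h.trans h') :=
  (Spec.map_comp _ _).symm

variable {A : FGSub k} {R : {B : FGSub k // A ≤ B} → Type u} [∀ i, CommRing (R i)]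
  (ρ : ∀ i : {B : FGSub k // A ≤ B}, i.1.1 →+* R i)

open Classical in
/-- The ring homomorphism from `k` to an ultraproduct of algebras over its subalgebras of finite
type. -/
noncomputable def toUltraproduct : k →+* Ultraproduct (ultrafilterAbove A) R where
  -- Each x of k lies in almost all of the subalgebras, so the default value does not affect the
  -- class.
  toFun x := Ideal.Quotient.mk _ fun i => if h : x ∈ i.1.1 then ρ i ⟨x, h⟩ else 0
  map_one' := by
    rw [← map_one (Ideal.Quotient.mk _), Ultraproduct.mk_eq_mk_iff]
    refine .of_forall fun i => ?_
    rw [dif_pos (one_mem _)]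
    exact map_one (ρ i)
  map_zero' := by
    rw [Ultraproduct.mk_eq_zero_iff]
    refine .of_forall fun i => ?_
    rw [dif_pos (zero_mem _)]
    exact map_zero (ρ i)
  map_mul' x y := by
    rw [← map_mul, Ultraproduct.mk_eq_mk_iff]
    filter_upwards [eventually_mem A x, eventually_mem A y] with i hx hy
    rw [Pi.mul_apply, dif_pos hx, dif_pos hy, dif_pos (mul_mem hx hy), ← map_mul]
    rfl
  map_add' x y := by
    rw [← map_add, Ultraproduct.mk_eq_mk_iff]
    filter_upwards [eventually_mem A x, eventually_mem A y] with i hx hy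
    rw [Pi.add_apply, dif_pos hx, dif_pos hy, dif_pos (add_mem hx hy), ← map_add]
    rfl

/-- The restriction to `A` of a ring homomorphism on a larger subalgebra. -/
def restrictHom (i : {B : FGSub k // A ≤ B}) : A.1 →+* R i :=
  (ρ i).comp (Subalgebra.inclusion (show A.1 ≤ i.1.1 from i.2)).toRingHom

lemma toUltraproduct_comp_val : (toUltraproduct ρ).comp A.1.val.toRingHom =
    (Ideal.Quotient.mk _).comp (RingHom.pi (restrictHom ρ)) := by
  ext x
  refine Ultraproduct.mk_eq_mk_iff.mpr (.of_forall fun i => ?_)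
  exact dif_pos (i.2 x.2)

lemma specMap_toUltraproduct_comp_fromField :
    Spec.map (CommRingCat.ofHom (toUltraproduct ρ)) ≫ fromField A =
      Spec.map (CommRingCat.ofHom (Ideal.Quotient.mk _)) ≫
        Spec.map (CommRingCat.ofHom (RingHom.pi (restrictHom ρ))) := by
  rw [fromField, ← Spec.map_comp, ← Spec.map_comp, ← CommRingCat.ofHom_comp,
    ← CommRingCat.ofHom_comp, toUltraproduct_comp_val]

section

variable [∀ i, IsDomain (R i)] [∀ i, ValuationRing (R i)]
  {K : {B : FGSub k // A ≤ B} → Type u} [∀ i, Field (K i)] [∀ i, Algebra (R i) (K i)]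
  [∀ i, IsFractionRing (R i) (K i)]

variable (R K) in
/-- The product of the maps of valuation rings to their fields of fractions. -/
def prodAlgebraMap : (∀ i, R i) →+* ∀ i, K i :=
  RingHom.pi fun i => (algebraMap (R i) (K i)).comp (Pi.evalRingHom R i)

/-- Quasi-compactness of Z glues the points `a i` to one point over the product of the fields. Its
restriction to the ultraproduct, with the map from k, forms a valuative square over k. The lift of
that square is defined over the product of the R_i for i in a large J, and its components restrict
to `a i` for almost all i. -/
lemma exists_lift_of_existence {Z : Scheme.{u}} (p : Z ⟶ specSub A) [QuasiCompact p]
    [LocallyOfFinitePresentation p]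
    (H : ValuativeCriterion.Existence (pullback.snd p (fromField A)))
    (a : ∀ i, Spec (.of (K i)) ⟶ Z)
    (ha : ∀ i, a i ≫ p = Spec.map (CommRingCat.ofHom (algebraMap (R i) (K i))) ≫
      Spec.map (CommRingCat.ofHom (restrictHom ρ i))) :
    ∃ i, ∃ l : Spec (.of (R i)) ⟶ Z,
      Spec.map (CommRingCat.ofHom (algebraMap (R i) (K i))) ≫ l = a i ∧
        l ≫ p = Spec.map (CommRingCat.ofHom (restrictHom ρ i)) := by
  have : CompactSpace Z := QuasiCompact.compactSpace_of_compactSpace p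
  let U := ultrafilterAbove A
  let τ := Spec.map (CommRingCat.ofHom (RingHom.pi (restrictHom ρ)))
  obtain ⟨b, hb⟩ := pointsPi_surjective (fun i => .of (K i)) Z a
  replace hb (i) : Spec.map (CommRingCat.ofHom (Pi.evalRingHom K i)) ≫ b = a i := congrFun hb i
  let π := Spec.map (CommRingCat.ofHom (prodAlgebraMap R K))
  have hbp : b ≫ p = π ≫ τ := by
    refine pointsPi_injective (fun i => .of (K i)) (specSub A) (funext fun i => ?_)
    change Spec.map (CommRingCat.ofHom (Pi.evalRingHom K i)) ≫ b ≫ p =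
      Spec.map (CommRingCat.ofHom (Pi.evalRingHom K i)) ≫ π ≫ τ
    rw [← Category.assoc, hb, ha]
    simp only [π, τ, ← Spec.map_comp]
    rfl
  let qK := Spec.map (CommRingCat.ofHom (Ideal.Quotient.mk (U.zeroIdeal K)))
  let qR := Spec.map (CommRingCat.ofHom (Ideal.Quotient.mk (U.zeroIdeal R)))
  let η := Spec.map (CommRingCat.ofHom (algebraMap (Ultraproduct U R) (Ultraproduct U K)))
  let κ := Spec.map (CommRingCat.ofHom (toUltraproduct ρ))
  have hκ : κ ≫ fromField A = qR ≫ τ := specMap_toUltraproduct_comp_fromField ρ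
  have hη : η ≫ qR = qK ≫ π := by
    simp only [π, η, qR, qK, ← Spec.map_comp]
    rfl
  let V : ValuativeCommSq (pullback.snd p (fromField A)) :=
    { R := Ultraproduct U R
      K := Ultraproduct U K
      i₁ := pullback.lift (qK ≫ b) (η ≫ κ) (by
        rw [Category.assoc, hbp, Category.assoc, hκ, ← Category.assoc, ← hη, Category.assoc])
      i₂ := κ
      commSq := ⟨pullback.lift_snd _ _ _⟩ }
  obtain ⟨⟨l, hl₁, hl₂⟩⟩ := (H V).exists_lift
  have hlp : (l ≫ pullback.fst p (fromField A)) ≫ p = qR ≫ τ := by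
    rw [Category.assoc, pullback.condition, ← Category.assoc, hl₂, ← hκ]
  have hηl : η ≫ l ≫ pullback.fst p (fromField A) = qK ≫ b := by
    rw [← Category.assoc]
    exact (congrArg (· ≫ pullback.fst p (fromField A)) hl₁).trans (pullback.lift_fst _ _ _)
  obtain ⟨J, hJ, g, hg₁, hg₂⟩ := Ultraproduct.exists_ofProd_comp_eq p τ _ hlp
  let πJ : (∀ i : J, R i) →+* ∀ i : J, K i :=
    RingHom.pi fun i => (algebraMap (R i) (K i)).comp (Pi.evalRingHom (fun i : J => R i) i)
  have h := Ultraproduct.eventually_evalRingHom_comp_eq p (π ≫ τ) hJ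
    (Spec.map (CommRingCat.ofHom πJ) ≫ g)
    (Spec.map (CommRingCat.ofHom (Ultraproduct.restr K J)) ≫ b) ?_ ?_ ?_
  · obtain ⟨i, hi, hiJ⟩ := (h.and hJ).exists
    refine ⟨i, Spec.map (CommRingCat.ofHom (Pi.evalRingHom (fun i : J => R i) ⟨i, hiJ⟩)) ≫ g,
      ?_, ?_⟩
    · specialize hi hiJ
      rw [← Category.assoc, ← Spec.map_comp, ← Category.assoc, ← Spec.map_comp] at hi
      rw [← hb, ← Category.assoc, ← Spec.map_comp]
      exact hi
    · rw [Category.assoc, hg₂, ← Spec.map_comp, ← Spec.map_comp]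
      rfl
  · rw [Category.assoc, hg₂]
    simp only [π, τ, ← Spec.map_comp]
    rfl
  · rw [Category.assoc, hbp]
  · have e₁ : Spec.map (CommRingCat.ofHom (Ultraproduct.ofProd (R := K) J hJ)) ≫
        Spec.map (CommRingCat.ofHom (Ultraproduct.restr K J)) = qK := by
      rw [← Spec.map_comp, ← CommRingCat.ofHom_comp, Ultraproduct.ofProd_comp_restr]
    have e₂ : Spec.map (CommRingCat.ofHom (Ultraproduct.ofProd (R := K) J hJ)) ≫
        Spec.map (CommRingCat.ofHom πJ) =
          η ≫ Spec.map (CommRingCat.ofHom (Ultraproduct.ofProd (R := R) J hJ)) := by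
      rw [← Spec.map_comp, ← Spec.map_comp, ← CommRingCat.ofHom_comp, ← CommRingCat.ofHom_comp]
      congr 2
      ext f
      refine Ultraproduct.mk_eq_mk_iff.mpr (.of_forall fun i => ?_)
      by_cases hi : i ∈ J <;> simp [hi, πJ]
    rw [← Category.assoc, e₂, Category.assoc, hg₁, hηl, ← Category.assoc, e₁]

/-- The two families of lifts merge into two lifts of one valuative square over k. These coincide,
and by finite type the original lifts then coincide at almost all indices. -/
lemma exists_eq_of_uniqueness {Z : Scheme.{u}} (p : Z ⟶ specSub A) [QuasiCompact p]
    [QuasiSeparated p] [LocallyOfFiniteType p]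
    (H : ValuativeCriterion.Uniqueness (pullback.snd p (fromField A)))
    (l l' : ∀ i, Spec (.of (R i)) ⟶ Z)
    (hl : ∀ i, l i ≫ p = Spec.map (CommRingCat.ofHom (restrictHom ρ i)))
    (hl' : ∀ i, l' i ≫ p = Spec.map (CommRingCat.ofHom (restrictHom ρ i)))
    (h : ∀ i, Spec.map (CommRingCat.ofHom (algebraMap (R i) (K i))) ≫ l i =
      Spec.map (CommRingCat.ofHom (algebraMap (R i) (K i))) ≫ l' i) : ∃ i, l i = l' i := by
  have : CompactSpace Z := QuasiCompact.compactSpace_of_compactSpace p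
  have : QuasiSeparatedSpace Z := quasiSeparatedSpace_of_quasiSeparated p
  let U := ultrafilterAbove A
  let τ := Spec.map (CommRingCat.ofHom (RingHom.pi (restrictHom ρ)))
  have key (l : ∀ i, Spec (.of (R i)) ⟶ Z)
      (hl : ∀ i, l i ≫ p = Spec.map (CommRingCat.ofHom (restrictHom ρ i))) :
      ∃ m : Spec (.of (∀ i, R i)) ⟶ Z,
        (∀ i, Spec.map (CommRingCat.ofHom (Pi.evalRingHom R i)) ≫ m = l i) ∧ m ≫ p = τ := by
    obtain ⟨m, hm⟩ := pointsPi_surjective (fun i => .of (R i)) Z l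
    replace hm (i) : Spec.map (CommRingCat.ofHom (Pi.evalRingHom R i)) ≫ m = l i := congrFun hm i
    refine ⟨m, hm, pointsPi_injective (fun i => .of (R i)) (specSub A) (funext fun i => ?_)⟩
    change Spec.map (CommRingCat.ofHom (Pi.evalRingHom R i)) ≫ m ≫ p =
      Spec.map (CommRingCat.ofHom (Pi.evalRingHom R i)) ≫ τ
    rw [← Category.assoc, hm, hl]
    simp only [τ, ← Spec.map_comp]
    rfl
  obtain ⟨m, hm, hmp⟩ := key l hl
  obtain ⟨m', hm', hmp'⟩ := key l' hl'
  let π := Spec.map (CommRingCat.ofHom (prodAlgebraMap R K))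
  have hπ : π ≫ m = π ≫ m' := by
    refine pointsPi_injective (fun i => .of (K i)) Z (funext fun i => ?_)
    change Spec.map (CommRingCat.ofHom (Pi.evalRingHom K i)) ≫ π ≫ m =
      Spec.map (CommRingCat.ofHom (Pi.evalRingHom K i)) ≫ π ≫ m'
    have e : Spec.map (CommRingCat.ofHom (Pi.evalRingHom K i)) ≫ π =
        Spec.map (CommRingCat.ofHom (algebraMap (R i) (K i))) ≫
          Spec.map (CommRingCat.ofHom (Pi.evalRingHom R i)) := by
      simp only [π, ← Spec.map_comp]
      rfl
    rw [← Category.assoc, ← Category.assoc, e, Category.assoc, Category.assoc, hm, hm', h]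
  let qK := Spec.map (CommRingCat.ofHom (Ideal.Quotient.mk (U.zeroIdeal K)))
  let qR := Spec.map (CommRingCat.ofHom (Ideal.Quotient.mk (U.zeroIdeal R)))
  let η := Spec.map (CommRingCat.ofHom (algebraMap (Ultraproduct U R) (Ultraproduct U K)))
  let κ := Spec.map (CommRingCat.ofHom (toUltraproduct ρ))
  have hκ : κ ≫ fromField A = qR ≫ τ := specMap_toUltraproduct_comp_fromField ρ
  have hη : η ≫ qR = qK ≫ π := by
    simp only [π, η, qR, qK, ← Spec.map_comp]
    rfl
  let n := pullback.lift (f := p) (g := fromField A) (qR ≫ m) κ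
    (by rw [Category.assoc, hmp, hκ])
  let n' := pullback.lift (f := p) (g := fromField A) (qR ≫ m') κ
    (by rw [Category.assoc, hmp', hκ])
  have hn : η ≫ n' = η ≫ n := by
    refine pullback.hom_ext ?_ ?_
    · simp only [n, n', Category.assoc, pullback.lift_fst]
      rw [← Category.assoc, ← Category.assoc, hη, Category.assoc, Category.assoc, hπ]
    · simp only [n, n', Category.assoc, pullback.lift_snd]
  let V : ValuativeCommSq (pullback.snd p (fromField A)) :=
    { R := Ultraproduct U R
      K := Ultraproduct U K
      i₁ := η ≫ n
      i₂ := κ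
      commSq := ⟨by rw [Category.assoc, pullback.lift_snd]⟩ }
  have : n = n' := congrArg CommSq.LiftStruct.l ((H V).elim
    ⟨n, rfl, pullback.lift_snd _ _ _⟩ ⟨n', hn, pullback.lift_snd _ _ _⟩)
  have hq : qR ≫ m = qR ≫ m' := by
    exact (pullback.lift_fst _ _ _).symm.trans
      ((congrArg (· ≫ pullback.fst p (fromField A)) this).trans (pullback.lift_fst _ _ _))
  have h := Ultraproduct.eventually_evalRingHom_comp_eq (U := U) p τ (J := Set.univ)
    Filter.univ_mem (Spec.map (CommRingCat.ofHom (Ultraproduct.restr R _)) ≫ m)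
    (Spec.map (CommRingCat.ofHom (Ultraproduct.restr R _)) ≫ m') (by rw [Category.assoc, hmp])
    (by rw [Category.assoc, hmp']) ?_
  · obtain ⟨i, hi⟩ := h.exists
    specialize hi trivial
    rw [← Category.assoc, ← Spec.map_comp, ← Category.assoc, ← Spec.map_comp] at hi
    refine ⟨i, ?_⟩
    rw [← hm, ← hm']
    exact hi
  · have e : Spec.map (CommRingCat.ofHom (Ultraproduct.ofProd (U := U) (R := R) Set.univ
        Filter.univ_mem)) ≫ Spec.map (CommRingCat.ofHom (Ultraproduct.restr R Set.univ)) = qR := by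
      rw [← Spec.map_comp, ← CommRingCat.ofHom_comp, Ultraproduct.ofProd_comp_restr]
    rw [← Category.assoc, e, ← Category.assoc, e, hq]

end

/-- If `Z` is of finite presentation over `A` and proper over `k`, then it becomes proper over
a larger subalgebra of finite type. -/
theorem exists_isProper {Z : Scheme.{u}} (p : Z ⟶ specSub A) [QuasiCompact p]
    [QuasiSeparated p] [LocallyOfFinitePresentation p]
    [IsProper (pullback.snd p (fromField A))] :
    ∃ (B : FGSub k) (h : A ≤ B), IsProper (pullback.snd p (fromSub h)) := by
  have key (i : {B : FGSub k // A ≤ B}) (S : ValuativeCommSq (pullback.snd p (fromSub i.2))) :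
      ∃ ρ : i.1.1 →+* S.R, S.i₂ ≫ fromSub i.2 = Spec.map (CommRingCat.ofHom
        (ρ.comp (Subalgebra.inclusion (show A.1 ≤ i.1.1 from i.2)).toRingHom)) := by
    obtain ⟨ρ, hρ⟩ := Spec.map_surjective S.i₂
    refine ⟨ρ.hom, ?_⟩
    rw [← hρ]
    exact (Spec.map_comp _ _).symm
  obtain ⟨B, hB, h₁⟩ : ∃ (B : FGSub k) (h : A ≤ B),
      ValuativeCriterion.Existence (pullback.snd p (fromSub h)) := by
    -- A failure over every B supplies one unsolvable square for each index, and the ultraproduct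
    -- argument solves one of them. Uniqueness below is treated likewise, with pairs of distinct
    -- lifts.
    by_contra! hne
    have hne' (i : {B : FGSub k // A ≤ B}) :
        ∃ S : ValuativeCommSq (pullback.snd p (fromSub i.2)), ¬ S.commSq.HasLift := by
      simpa [ValuativeCriterion.Existence] using hne i.1 i.2
    choose S hS using hne'
    choose ρ hρ using fun i => key i (S i)
    have hE : (ValuativeCriterion.Existence ⊓ @QuasiCompact) (pullback.snd p (fromField A)) := by
      rw [← UniversallyClosed.eq_valuativeCriterion]
      exact (inferInstance : UniversallyClosed (pullback.snd p (fromField A)))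
    obtain ⟨i, l, h₁, h₂⟩ := exists_lift_of_existence (R := fun i => (S i).R)
      (K := fun i => (S i).K) ρ p
      hE.1
      (fun i => (S i).i₁ ≫ pullback.fst _ _) fun i => by
        rw [Category.assoc, pullback.condition, (S i).commSq.w_assoc, hρ]
        rfl
    refine hS i ⟨⟨pullback.lift l (S i).i₂ ?_, ?_, pullback.lift_snd _ _ _⟩⟩
    · rw [h₂, hρ]
      rfl
    · refine pullback.hom_ext ?_ ?_
      · rw [Category.assoc, pullback.lift_fst, h₁]
      · rw [Category.assoc, pullback.lift_snd, (S i).commSq.w]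
  obtain ⟨C, hC, h₂⟩ : ∃ (B : FGSub k) (h : A ≤ B),
      ValuativeCriterion.Uniqueness (pullback.snd p (fromSub h)) := by
    by_contra! hne
    have hne' (i : {B : FGSub k // A ≤ B}) :
        ∃ S : ValuativeCommSq (pullback.snd p (fromSub i.2)),
          ∃ l l' : S.commSq.LiftStruct, l ≠ l' := by
      have := hne i.1 i.2
      simp only [ValuativeCriterion.Uniqueness, not_forall] at this
      obtain ⟨S, hS⟩ := this
      rw [not_subsingleton_iff_nontrivial] at hS
      exact ⟨S, hS.exists_pair_ne⟩
    choose S l l' hS using hne'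
    choose ρ hρ using fun i => key i (S i)
    have aux (i) (l : (S i).commSq.LiftStruct) : (l.l ≫ pullback.fst _ _) ≫ p =
        Spec.map (CommRingCat.ofHom (restrictHom (R := fun i => (S i).R) ρ i)) := by
      rw [Category.assoc, pullback.condition, ← Category.assoc, l.fac_right, hρ]
      rfl
    obtain ⟨i, hi⟩ := exists_eq_of_uniqueness (R := fun i => (S i).R)
      (K := fun i => (S i).K) ρ p (IsSeparated.valuativeCriterion _)
      (fun i => (l i).l ≫ pullback.fst _ _) (fun i => (l' i).l ≫ pullback.fst _ _)
      (fun i => aux i _) (fun i => aux i _) fun i => by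
        rw [← Category.assoc, (l i).fac_left, ← Category.assoc, (l' i).fac_left]
    refine hS i (CommSq.LiftStruct.ext (pullback.hom_ext hi ?_))
    rw [(l i).fac_right, (l' i).fac_right]
  -- Universal closedness and separatedness are stable under base change, so both hold over a common
  -- larger subalgebra.
  obtain ⟨D, hBD, hCD⟩ := exists_ge_ge B C
  have aux {B D : FGSub k} (h : A ≤ B) (h' : B ≤ D) :
      IsPullback (pullback.lift (pullback.fst p (fromSub (h.trans h')))
        (pullback.snd p (fromSub (h.trans h')) ≫ fromSub h') (by
          rw [pullback.condition, Category.assoc, fromSub_comp_fromSub]))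
        (pullback.snd p (fromSub (h.trans h'))) (pullback.snd p (fromSub h)) (fromSub h') := by
    refine .of_right ?_ (pullback.lift_snd _ _ _) (IsPullback.of_hasPullback p (fromSub h))
    rw [pullback.lift_fst, fromSub_comp_fromSub]
    exact .of_hasPullback _ _
  refine ⟨D, hB.trans hBD, ?_⟩
  have : QuasiCompact (pullback.snd p (fromSub hB)) := inferInstance
  have : UniversallyClosed (pullback.snd p (fromSub hB)) := .of_valuativeCriterion _ h₁
  have : IsSeparated (pullback.snd p (fromSub hC)) := .of_valuativeCriterion _ h₂
  have : UniversallyClosed (pullback.snd p (fromSub (hB.trans hBD))) :=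
    MorphismProperty.of_isPullback (aux hB hBD) ‹_›
  have : IsSeparated (pullback.snd p (fromSub (hB.trans hBD))) :=
    MorphismProperty.of_isPullback (aux hC hCD) ‹_›
  exact ⟨⟩

end SchemeRealization

/-! ### Images in a realization -/

namespace SchemeRealization

section

variable {S : Scheme.{u}} {X Y : Over S}

/-- The morphism from the source of `f` to its scheme-theoretic image is universally
scheme-theoretically dominant. -/
def ImageUniversal (f : X ⟶ Y) : Prop :=
  ∀ ⦃T : Scheme.{u}⦄ (t : T ⟶ S),
    SchemeTheoreticallyDominantAfter f.left.toImage (f.left.imageι ≫ Y.hom) t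

/-- If the source and the target of `f'` are base changes of those of `f`, compatibly, then `f'` is
a base change of `f`. -/
lemma isPullback_left {T : Scheme.{u}} {X' Y' : Over T} (f : X ⟶ Y) (f' : X' ⟶ Y') {t : T ⟶ S}
    {x : X'.left ⟶ X.left} {y : Y'.left ⟶ Y.left} (hx : IsPullback x X'.hom X.hom t)
    (hy : IsPullback y Y'.hom Y.hom t) (h : x ≫ f.left = f'.left ≫ y) :
    IsPullback x f'.left f.left y :=
  .of_bot (by simpa using hx) h hy

lemma ImageUniversal.exists_isPullback {f : X ⟶ Y} (H : ImageUniversal f) {T : Scheme.{u}}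
    {X' Y' : Over T} {f' : X' ⟶ Y'} {t : T ⟶ S}
    {x : X'.left ⟶ X.left} {y : Y'.left ⟶ Y.left} (hx : IsPullback x X'.hom X.hom t)
    (hy : IsPullback y Y'.hom Y.hom t) (h : x ≫ f.left = f'.left ≫ y) :
    ∃ m : (im f').left ⟶ (im f).left, m ≫ (imι f).left = (imι f').left ≫ y ∧
      IsPullback m (im f').hom (im f).hom t := by
  obtain ⟨m, hm, -⟩ := (H t).exists_isPullback (isPullback_left f f' hx hy h) hy
  exact ⟨m, hm.w, hm.paste_vert hy⟩

/-- The case of the identity of T identifies `f'.left.toImage` with the base change of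
`f.left.toImage`; further base changes of it are then base changes of the latter. -/
lemma SchemeTheoreticallyDominantAfter.imageUniversal {f : X ⟶ Y} {T : Scheme.{u}}
    {X' Y' : Over T} {f' : X' ⟶ Y'} {t : T ⟶ S}
    (H : ∀ ⦃T' : Scheme.{u}⦄ (t' : T' ⟶ T),
      SchemeTheoreticallyDominantAfter f.left.toImage (f.left.imageι ≫ Y.hom) (t' ≫ t))
    {x : X'.left ⟶ X.left} {y : Y'.left ⟶ Y.left} (hx : IsPullback x X'.hom X.hom t)
    (hy : IsPullback y Y'.hom Y.hom t) (h : x ≫ f.left = f'.left ≫ y) :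
    ImageUniversal f' := by
  intro T' t'
  have Ht : SchemeTheoreticallyDominantAfter f.left.toImage (f.left.imageι ≫ Y.hom) t := by
    simpa using H (𝟙 T)
  obtain ⟨m, hm, hm'⟩ := Ht.exists_isPullback (isPullback_left f f' hx hy h) hy
  exact (H t').of_isPullback hm' (hm.paste_vert hy)

lemma ImageUniversal.imCommutesWith {f : X ⟶ Y} (H : ImageUniversal f) {T : Scheme.{u}}
    (t : T ⟶ S) : ImCommutesWith f t := by
  have hx := IsPullback.of_hasPullback X.hom t
  have hy := IsPullback.of_hasPullback Y.hom t
  obtain ⟨m, hm, hm'⟩ := H.exists_isPullback (X' := (Over.pullback t).obj X)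
    (Y' := (Over.pullback t).obj Y) (f' := (Over.pullback t).map f) hx hy
    (pullback.lift_fst _ _ _).symm
  refine ⟨Over.isoMk hm'.isoPullback hm'.isoPullback_hom_snd, ?_⟩
  ext1
  refine pullback.hom_ext ?_ ?_
  · change (hm'.isoPullback.hom ≫ pullback.lift _ _ _) ≫ pullback.fst _ _ = _
    rw [Category.assoc, pullback.lift_fst, ← Category.assoc, hm'.isoPullback_hom_fst, hm]
  · change (hm'.isoPullback.hom ≫ pullback.lift _ _ _) ≫ pullback.snd _ _ = _
    rw [Category.assoc, pullback.lift_snd, hm'.isoPullback_hom_snd]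
    rfl

/-- Each geometric fiber of the image is dominated by the corresponding fiber of X, which is
integral. -/
lemma ImageUniversal.geometricallyIntegral {f : X ⟶ Y} (H : ImageUniversal f)
    [QuasiCompact f.left] [GeometricallyIntegral X.hom] : GeometricallyIntegral (im f).hom := by
  refine ⟨fun K _ t Z' (z : Z' ⟶ f.left.image) p'
    (hz : IsPullback z p' (f.left.imageι ≫ Y.hom) t) => ?_⟩
  have hX := IsPullback.of_hasPullback X.hom t
  have hint : IsIntegral (pullback X.hom t) :=
    GeometricallyIntegral.geometrically_isIntegral t _ _ hX
  have hw : f.left.toImage ≫ f.left.imageι ≫ Y.hom = X.hom := by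
    simp
  let h' : pullback X.hom t ⟶ Z' :=
    hz.lift (pullback.fst _ _ ≫ f.left.toImage) (pullback.snd _ _)
      (by rw [Category.assoc, hw, pullback.condition])
  have hh' : IsPullback (pullback.fst X.hom t) h' f.left.toImage z :=
    .of_bot (by rwa [hz.lift_snd, hw]) (hz.lift_fst _ _ _).symm hz
  have := H t _ _ _ _ hh' hz
  have : QuasiCompact h' := MorphismProperty.of_isPullback hh' inferInstance
  exact IsSchemeTheoreticallyDominant.isIntegral h'

lemma quasiCompact_left (f : X ⟶ Y) [QuasiCompact X.hom] [QuasiSeparated Y.hom] :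
    QuasiCompact f.left := by
  have : QuasiCompact (f.left ≫ Y.hom) := by rwa [Over.w]
  exact .of_comp f.left Y.hom

end

variable {k : Type u} [Field k]

instance (A : FGSub k) : IsNoetherianRing A.1 := by
  have := A.1.fg_iff_finiteType.mp A.2
  exact Algebra.FiniteType.isNoetherianRing ℤ A.1

/-- Adjoining the inverse of s in k: shrinking Spec A amounts to enlarging A. -/
lemma exists_isUnit_inclusion (A : FGSub k) {s : A.1} (hs : s ≠ 0) :
    ∃ (B : FGSub k) (_ : A ≤ B), ∀ (C : FGSub k) (_ : B ≤ C) (hAC : A ≤ C),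
      IsUnit (Subalgebra.inclusion (show A.1 ≤ C.1 from hAC) s) := by
  obtain ⟨B, hAB, hB⟩ := exists_le_mem A (s : k)⁻¹
  refine ⟨B, hAB, fun C hBC hAC => .of_mul_eq_one ⟨(s : k)⁻¹, hBC hB⟩ (Subtype.ext ?_)⟩
  exact mul_inv_cancel₀ (by simpa using hs)

end SchemeRealization

namespace SchemeRealization

variable {k : Type u} [Field k]

section

variable {S : Scheme.{u}} {X Y : Over S} (f : X ⟶ Y)

instance [LocallyOfFiniteType Y.hom] : LocallyOfFiniteType (im f).hom :=
  inferInstanceAs (LocallyOfFiniteType (f.left.imageι ≫ Y.hom))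

instance [QuasiCompact Y.hom] : QuasiCompact (im f).hom :=
  inferInstanceAs (QuasiCompact (f.left.imageι ≫ Y.hom))

instance [QuasiSeparated Y.hom] : QuasiSeparated (im f).hom :=
  inferInstanceAs (QuasiSeparated (f.left.imageι ≫ Y.hom))

instance [IsProper Y.hom] : IsProper (im f).hom :=
  inferInstanceAs (IsProper (f.left.imageι ≫ Y.hom))

end

section

variable {A₀ : FGSub k} {X Y : Over (specField k)} {XA YA : ∀ A : FGSub k, A₀ ≤ A → Over (specSub A)}

/-- Generic flatness makes the model flat; a flat model with integral geometric fibers over a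
Noetherian domain has integral total space. -/
lemma Realization.exists_flat_geometricallyIntegral (RX : Realization X XA)
    (hX : ∃ A hA, GeometricallyIntegral (XA A hA).hom) :
    ∃ (B : FGSub k) (hB : A₀ ≤ B), ∀ (C : FGSub k) (hC : B ≤ C),
      Flat (XA C (hB.trans hC)).hom ∧ GeometricallyIntegral (XA C (hB.trans hC)).hom ∧
        AlgebraicGeometry.IsIntegral (XA C (hB.trans hC)).left := by
  obtain ⟨A, hA, hgeom⟩ := hX
  have := RX.locallyOfFinitePresentation A hA
  have := RX.quasiCompact A hA
  obtain ⟨s, hs, H⟩ := exists_flat_of_isPullback (A := A.1) (XA A hA).hom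
  obtain ⟨B, hAB, hB⟩ := exists_isUnit_inclusion A hs
  refine ⟨B, hA.trans hAB, fun C hBC => ?_⟩
  have hAC := hAB.trans hBC
  have h1 : Flat (XA C (hA.trans hAC)).hom :=
    H _ _ (hB C hBC hAC) _ _ (RX.isPullback_trans hA hAC)
  have h2 : GeometricallyIntegral (XA C (hA.trans hAC)).hom :=
    MorphismProperty.of_isPullback (RX.isPullback_trans hA hAC) hgeom
  have := RX.locallyOfFinitePresentation C (hA.trans hAC)
  exact ⟨h1, h2, GeometricallyIntegral.isIntegral_of_isLocallyNoetherian
    (XA C (hA.trans hAC)).hom⟩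

variable {RX : Realization X XA} {RY : Realization Y YA} {f : X ⟶ Y}
  {fA : ∀ A hA, XA A hA ⟶ YA A hA}

lemma RealizesHom.exists_imageUniversal (hf : RealizesHom RX RY f fA) {A : FGSub k} (hA : A₀ ≤ A)
    [AlgebraicGeometry.IsIntegral (XA A hA).left] :
    ∃ (B : FGSub k) (hB : A ≤ B), ∀ (C : FGSub k) (hC : B ≤ C),
      ImageUniversal (fA C (hA.trans (hB.trans hC))) ∧
        Flat (im (fA C (hA.trans (hB.trans hC)))).hom := by
  have := RX.locallyOfFinitePresentation A hA
  have := RX.quasiCompact A hA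
  have := RY.locallyOfFinitePresentation A hA
  have := RY.quasiCompact A hA
  have := RY.quasiSeparated A hA
  have := quasiCompact_left (fA A hA)
  let g := (fA A hA).left
  have : IsIntegral g.image := IsSchemeTheoreticallyDominant.isIntegral g.toImage
  have : LocallyOfFiniteType (g.toImage ≫ g.imageι ≫ (YA A hA).hom) := by
    simpa [g] using (inferInstance : LocallyOfFiniteType (XA A hA).hom)
  obtain ⟨s, hs, H⟩ := exists_schemeTheoreticallyDominantAfter (A := A.1) g.toImage
    (g.imageι ≫ (YA A hA).hom)
  obtain ⟨s', hs', H'⟩ := exists_flat_of_isPullback (A := A.1) (im (fA A hA)).hom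
  obtain ⟨B₁, hAB₁, hB₁⟩ := exists_isUnit_inclusion A hs
  obtain ⟨B₂, hAB₂, hB₂⟩ := exists_isUnit_inclusion A hs'
  obtain ⟨B, h₁, h₂⟩ := exists_ge_ge B₁ B₂
  refine ⟨B, hAB₁.trans h₁, fun C hBC => ?_⟩
  have hAC := hAB₁.trans (h₁.trans hBC)
  have H₁ ⦃T : Scheme.{u}⦄ (t : T ⟶ specSub C) :
      SchemeTheoreticallyDominantAfter g.toImage (g.imageι ≫ (YA A hA).hom) (t ≫ fromSub hAC) :=
    H _ _ (hB₁ C (h₁.trans hBC) hAC) T t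
  have hU := SchemeTheoreticallyDominantAfter.imageUniversal H₁ (RX.isPullback_trans hA hAC)
    (RY.isPullback_trans hA hAC) (hf.trans_comm hA hAC)
  refine ⟨hU, ?_⟩
  -- The image over C is the base change of the image over A, so generic flatness of the latter
  -- applies to it.
  have H₂ : SchemeTheoreticallyDominantAfter g.toImage (g.imageι ≫ (YA A hA).hom)
    (fromSub hAC) := by simpa using H₁ (𝟙 _)
  obtain ⟨m, hm, -⟩ := H₂.exists_isPullback (isPullback_left _ _ (RX.isPullback_trans hA hAC)
    (RY.isPullback_trans hA hAC) (hf.trans_comm hA hAC)) (RY.isPullback_trans hA hAC)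
  exact H' _ _ (hB₂ C (h₂.trans hBC) hAC) _ _ (hm.paste_vert (RY.isPullback_trans hA hAC))

/-- The base change of Im f_A to k is Im f, which is closed in the proper scheme Y. Its properness
spreads out to some B, and passes to every larger C because Im f_C is again a base change. -/
lemma RealizesHom.exists_isProper_im (hf : RealizesHom RX RY f fA) [IsProper Y.hom] {A : FGSub k}
    (hA : A₀ ≤ A) (H : ImageUniversal (fA A hA)) :
    ∃ (B : FGSub k) (hB : A ≤ B), ∀ (C : FGSub k) (hC : B ≤ C),
      IsProper (im (fA C (hA.trans (hB.trans hC)))).hom := by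
  have := RY.locallyOfFinitePresentation A hA
  have := RY.quasiCompact A hA
  have := RY.quasiSeparated A hA
  obtain ⟨m, -, hm⟩ := H.exists_isPullback (RX.isPullback_toModel A hA)
    (RY.isPullback_toModel A hA) (hf.toModel_comm A hA)
  have : IsProper (pullback.snd (im (fA A hA)).hom (fromField A)) := by
    rw [← hm.isoPullback_inv_snd]
    infer_instance
  obtain ⟨B, hAB, hB⟩ := exists_isProper (im (fA A hA)).hom
  refine ⟨B, hAB, fun C hBC => ?_⟩
  obtain ⟨n, -, hn⟩ := H.exists_isPullback (RX.isPullback_trans hA (hAB.trans hBC))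
    (RY.isPullback_trans hA (hAB.trans hBC)) (hf.trans_comm hA (hAB.trans hBC))
  have h : IsPullback
      (pullback.lift n ((im (fA C (hA.trans (hAB.trans hBC)))).hom ≫ fromSub hBC)
        (by rw [Category.assoc, fromSub_comp_fromSub, hn.w]))
      (im (fA C (hA.trans (hAB.trans hBC)))).hom
      (pullback.snd (im (fA A hA)).hom (fromSub hAB)) (fromSub hBC) := by
    refine .of_right ?_ (pullback.lift_snd _ _ _) (IsPullback.of_hasPullback _ _)
    rw [pullback.lift_fst, fromSub_comp_fromSub]
    exact hn
  exact MorphismProperty.of_isPullback h hB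

/-- If the formation of the images commutes with base change, then they realize the image. -/
lemma RealizesHom.exists_realization_im (hf : RealizesHom RX RY f fA) {A₁ : FGSub k}
    (h : A₀ ≤ A₁) (H : ∀ A (hA : A₁ ≤ A), ImageUniversal (fA A (h.trans hA))) :
    ∃ RI : Realization (im f) (fun A (hA : A₁ ≤ A) => im (fA A (h.trans hA))),
      RealizesHom RI (RY.restrict h) (imι f) (fun A (hA : A₁ ≤ A) => imι (fA A (h.trans hA))) ∧
        ((RY.restrict h).IsCoherent → RI.IsCoherent) := by
  choose m hm hm' using fun A (hA : A₁ ≤ A) => (H A hA).exists_isPullback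
    (RX.isPullback_toModel A (h.trans hA)) (RY.isPullback_toModel A (h.trans hA))
    (hf.toModel_comm A (h.trans hA))
  choose n hn hn' using fun (A B : FGSub k) (hA : A₁ ≤ A) (hAB : A ≤ B) =>
    (H A hA).exists_isPullback
      (RX.isPullback_trans (h.trans hA) hAB) (RY.isPullback_trans (h.trans hA) hAB)
      (hf.trans_comm (h.trans hA) hAB)
  have hmono (A) (hA : A₁ ≤ A) : Mono (imι (fA A (h.trans hA))).left :=
    inferInstanceAs (Mono (fA A (h.trans hA)).left.imageι)
  let RI : Realization (im f) (fun A (hA : A₁ ≤ A) => im (fA A (h.trans hA))) :=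
    -- The image is closed in Y_A, hence of finite type, and A is Noetherian.
    { locallyOfFinitePresentation := fun A hA => by
        have := RY.locallyOfFinitePresentation A (h.trans hA)
        infer_instance
      quasiCompact := fun A hA => by
        have := RY.quasiCompact A (h.trans hA)
        infer_instance
      quasiSeparated := fun A hA => by
        have := RY.quasiSeparated A (h.trans hA)
        infer_instance
      toModel := m
      isPullback_toModel := hm'
      trans := fun hA hAB => n _ _ hA hAB
      isPullback_trans := fun hA hAB => hn' _ _ hA hAB }
  -- The cocycle conditions can be checked after composing with the monomorphisms into the Y_A,
  -- where they are those of Y.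
  refine ⟨RI, ⟨hm, fun hA hAB => hn _ _ hA hAB⟩, fun hc => ⟨fun {A} hA => ?_,
    fun {A B C} hA hAB hBC => ?_, fun {A B} hA hAB => ?_⟩⟩
  · refine (hmono A hA).right_cancellation _ _ ((hn A A hA le_rfl).trans ?_)
    have e : RY.trans (h.trans hA) le_rfl = 𝟙 _ := hc.trans_refl hA
    rw [e]
    exact (Category.comp_id _).trans (Category.id_comp _).symm
  · refine (hmono A hA).right_cancellation _ _ ?_
    have e : RY.trans (h.trans (hA.trans hAB)) hBC ≫ RY.trans (h.trans hA) hAB =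
        RY.trans (h.trans hA) (hAB.trans hBC) := hc.trans_trans hA hAB hBC
    refine Eq.trans ?_ (hn A C hA (hAB.trans hBC)).symm
    change (n B C (hA.trans hAB) hBC ≫ n A B hA hAB) ≫ _ = _
    rw [Category.assoc, hn A B hA hAB, ← Category.assoc, hn B C (hA.trans hAB) hBC,
      Category.assoc, e]
  · refine (hmono A hA).right_cancellation _ _ ?_
    have e : RY.toModel B (h.trans (hA.trans hAB)) ≫ RY.trans (h.trans hA) hAB =
        RY.toModel A (h.trans hA) := hc.toModel_trans hA hAB
    refine Eq.trans ?_ (hm A hA).symm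
    change (m B (hA.trans hAB) ≫ n A B hA hAB) ≫ _ = _
    rw [Category.assoc, hn A B hA hAB, ← Category.assoc, hm B (hA.trans hAB), Category.assoc, e]

end

end SchemeRealization

open SchemeRealization in
theorem theorem4p4 {k : Type u} [Field k] {X Y : Over (specField k)}
    [LocallyOfFiniteType X.hom] [QuasiCompact X.hom] [IsProper Y.hom]
    (f : X ⟶ Y) {A₀ : FGSub k}
    {XA YA : ∀ A : FGSub k, A₀ ≤ A → Over (specSub A)}
    (RX : Realization X XA) (RY : Realization Y YA)
    (fA : ∀ A hA, XA A hA ⟶ YA A hA) (hf : RealizesHom RX RY f fA)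
    (hX : ∃ A hA, GeometricallyIntegral (XA A hA).hom) :
    AlgebraicGeometry.IsIntegral X.left ∧
    ∃ (A₁ : FGSub k) (h : A₀ ≤ A₁),
      (∃ RI : Realization (im f) (fun A (hA : A₁ ≤ A) => im (fA A (h.trans hA))),
        RealizesHom RI (RY.restrict h) (imι f)
          (fun A (hA : A₁ ≤ A) => imι (fA A (h.trans hA))) ∧
        ((RY.restrict h).IsCoherent → RI.IsCoherent)) ∧
      ∀ (A : FGSub k) (hA : A₁ ≤ A),
        (AlgebraicGeometry.IsIntegral (XA A (h.trans hA)).left ∧ Flat (XA A (h.trans hA)).hom) ∧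
        (AlgebraicGeometry.IsIntegral (im (fA A (h.trans hA))).left ∧
          GeometricallyIntegral (im (fA A (h.trans hA))).hom ∧
          Flat (im (fA A (h.trans hA))).hom ∧
          IsProper (im (fA A (h.trans hA))).hom ∧
          LocallyOfFinitePresentation (im (fA A (h.trans hA))).hom ∧
          QuasiCompact (im (fA A (h.trans hA))).hom ∧
          QuasiSeparated (im (fA A (h.trans hA))).hom) ∧
        (∀ (T : Scheme.{u}) [Nonempty T] (t : T ⟶ specSub A),
          AlgebraicGeometry.IsIntegral ((Over.pullback t).obj (im (fA A (h.trans hA)))).left →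
          AlgebraicGeometry.IsIntegral ((Over.pullback t).obj (XA A (h.trans hA))).left →
          ImCommutesWith (fA A (h.trans hA)) t) ∧
        (∀ s : specSub A, ImCommutesWith (fA A (h.trans hA)) (geometricPoint s)) := by
  obtain ⟨B₀, h₀, H₀⟩ := RX.exists_flat_geometricallyIntegral hX
  obtain ⟨-, -, hint⟩ := H₀ B₀ le_rfl
  obtain ⟨B₁, h₁, H₁⟩ := hf.exists_imageUniversal h₀
  obtain ⟨A₁, h₂, H₂⟩ := hf.exists_isProper_im (h₀.trans h₁) (H₁ B₁ le_rfl).1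
  have h := h₀.trans (h₁.trans h₂)
  obtain ⟨A, hA, hgeom⟩ := hX
  -- X is integral because it is the base change of a geometrically integral X_A along a
  -- field-valued point of Spec A.
  refine ⟨GeometricallyIntegral.geometrically_isIntegral _ _ _ (RX.isPullback_toModel A hA), A₁, h,
    hf.exists_realization_im h fun A hA => (H₁ A (h₂.trans hA)).1, fun A hA => ?_⟩
  obtain ⟨hflat, hgeom, hint⟩ := H₀ A (h₁.trans (h₂.trans hA))
  obtain ⟨hU, hflat'⟩ := H₁ A (h₂.trans hA)
  have := RX.quasiCompact A (h.trans hA)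
  have := RY.quasiSeparated A (h.trans hA)
  have := RY.quasiCompact A (h.trans hA)
  have := RY.locallyOfFinitePresentation A (h.trans hA)
  have := quasiCompact_left (fA A (h.trans hA))
  have him : AlgebraicGeometry.IsIntegral (fA A (h.trans hA)).left.image :=
    IsSchemeTheoreticallyDominant.isIntegral (fA A (h.trans hA)).left.toImage
  exact ⟨⟨hint, hflat⟩, ⟨him,
    hU.geometricallyIntegral, hflat', H₂ A hA, inferInstance, inferInstance, inferInstance⟩,
    fun T _ t _ _ => hU.imCommutesWith t, fun s => hU.imCommutesWith _⟩
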